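/- All graphs are finite directed graphs without loops and parallel edges. A flow graph has a distinguished source $s(G)$ that reaches every vertex; an isomorphism of flow graphs is an edge-preserving and edge-reflecting bijection of the vertices that maps the source to the source. An edge $vw$ of a flow graph is a cycle edge if, in a depth-first search from $s(G)$, $v$ is inserted in the stack after $w$ and before the removal of $w$ (for reducible graphs this does not depend on the search). A vertex $w$ is a descendant of $v$ if there is a directed path (possibly of length $0$) from $v$ to $w$ that uses no cycle edge. The non-trivial statement graphs $H$, with source $v$, sink $t$, and $\mathrm{type}(H)$, are: sequence (type 2): edge $vt$; if (type 3): edges $vx, xt, vt$; while (type 4): edges $vx, xv, vt$; repeat (type 5): edges $vx, xv, xt$; if-then-else (type 6): edges $vx_1,vx_2,x_1t,x_2t$; $p$-case, $p\ge 3$ (type $p+4$): edges $vx_i, x_it$ for $1\le i\le p$. Expanding a vertex $u$ of $G$ into a statement graph $H$ means replacing $u$ by $H$ so that the in-edges of $u$ enter $s(H)$ and the out-edges of $u$ leave $t(H)$. Dijkstra graphs are defined recursively: the one-vertex graph, with its vertex labeled $X$, is a Dijkstra graph; and a graph obtained from a Dijkstra graph by expanding a vertex labeled $X$ into a non-trivial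 statement graph $H$ is one, where $s(H)$ is labeled $R$, the other vertices of $H$ are labeled $X$, and all other labels are unchanged. The source of a Dijkstra graph is the vertex descending from the original one as source. Labels are then forgotten. A prime subgraph of $G$ is an induced subgraph $H$ that is isomorphic to a non-trivial statement graph, by an isomorphism under which the cycle edges of $G$ lying in $H$ correspond to the cycle edges of the statement graph, and that is closed: every in-neighbor in $G$ of a vertex of $H$ other than $s(H)$ lies in $H$, every out-neighbor of a vertex of $H$ other than $t(H)$ lies in $H$, and if $w\,s(H)$ is a cycle edge of $G$ then $s(H)\,w$ is an edge. The contraction $G\downarrow H$ identifies all vertices of $H$ with $s(H)$ and removes loops and parallel edges. A bottom-up contractile sequence repeatedly contracts a prime subgraph $H$ for which no other prime subgraph of the current graph has its source among the descendants of $s(H)$, until there is no prime subgraph left. Codes are strings of positive integers; $\|$ is concatenation, and $\mathrm{lex}$ concatenates its argument strings in non-decreasing lexicographic order. At the beginning every vertex has the code $C(u)=1$. Whenever a prime subgraph $H$ with source $v$ is contracted, $C(v)$ is replaced by $C(v)\,\|\,C(H)$, where, with the notation above, $C(H)=2\|C(t)$ for a sequence, $3\|C(x)\|C(t)$ for an if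 graph, $4\|C(x)\|C(t)$ for a while graph, $5\|C(x)\|C(t)$ for a repeat graph, $6\|\mathrm{lex}(C(x_1),C(x_2))\|C(t)$ for an if-then-else graph, and $(p+4)\|\mathrm{lex}(C(x_1),\dots,C(x_p))\|C(t)$ for a $p$-case graph. The code $C(G)$ is the code of the source at the end. Theorem. Every Dijkstra graph $G$ has exactly one code $C(G)$, that is, $C(G)$ does not depend on the bottom-up contractile sequence chosen; and two Dijkstra graphs $G$ and $G'$ are isomorphic (as flow graphs) if and only if $C(G)=C(G')$. -/

import Mathlib

universe u v

namespace StructuredProgram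

/-- A directed graph without parallel edges, with a distinguished vertex `source`
(for all graphs considered below the source reaches every vertex). -/
structure RootedDigraph where
  V : Type u
  graph : Digraph V
  source : V

namespace RootedDigraph

/-- `v w` is an edge. -/
abbrev Adj (G : RootedDigraph.{u}) (v w : G.V) : Prop := G.graph.Adj v w

/-- Isomorphism of flow graphs: a bijection of the vertices that preserves and reflects edges and
carries the distinguished source to the distinguished source. -/
structure Iso (G : RootedDigraph.{u}) (H : RootedDigraph.{v}) where
  toEquiv : G.V ≃ H.V
  map_adj : ∀ a b : G.V, G.Adj a b ↔ H.Adj (toEquiv a) (toEquiv b)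
  map_source : toEquiv G.source = H.source

/-- The flow graphs `G` and `H` are isomorphic. -/
def Isomorphic (G : RootedDigraph.{u}) (H : RootedDigraph.{v}) : Prop := Nonempty (G.Iso H)

/-- `G.DFSState stack visited`: some depth-first search of `G` from its source reaches a moment
at which its stack is `stack` (top first) and the vertices inserted so far are `visited`. -/
inductive DFSState (G : RootedDigraph.{u}) : List G.V → Set G.V → Prop
  | start : DFSState G [G.source] {G.source}
  | push {v w : G.V} {stack : List G.V} {visited : Set G.V} :
      DFSState G (v :: stack) visited → G.Adj v w → w ∉ visited →
      DFSState G (w :: v :: stack) (insert w visited)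
  | pop {v : G.V} {stack : List G.V} {visited : Set G.V} :
      DFSState G (v :: stack) visited → (∀ w, G.Adj v w → w ∈ visited) →
      DFSState G stack visited

/-- `v w` is a cycle edge: an edge such that, in a depth-first search from the source, `v` is
inserted in the stack after `w` and before the removal of `w`, i.e. `w` is below `v` in the stack.
(For reducible graphs this does not depend on the search.) -/
def IsCycleEdge (G : RootedDigraph.{u}) (v w : G.V) : Prop :=
  G.Adj v w ∧ ∃ (stack : List G.V) (visited : Set G.V),
    G.DFSState (v :: stack) visited ∧ w ∈ stack

/-- `G.IsDescendant a d`: `d` is a descendant of `a` in `G` without its cycle edges. -/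
def IsDescendant (G : RootedDigraph.{u}) (a d : G.V) : Prop :=
  Relation.ReflTransGen (fun x y => G.Adj x y ∧ ¬ G.IsCycleEdge x y) a d

end RootedDigraph

/-- The kinds of non-trivial statement graphs. -/
inductive StatementKind where
  | sequence
  | ifThen
  | whileDo
  | repeatUntil
  | ifThenElse
  | pCase (p : ℕ) (hp : 3 ≤ p)

namespace StatementKind

/-- Number of vertices of the statement graph. -/
def order : StatementKind → ℕ
  | sequence => 2
  | ifThen => 3
  | whileDo => 3
  | repeatUntil => 3
  | ifThenElse => 4
  | pCase p _ => p + 2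

theorem order_pos (k : StatementKind) : 0 < k.order := by
  cases k <;> simp [order]

/-- The source is vertex number `0`. -/
def src (k : StatementKind) : Fin k.order := ⟨0, k.order_pos⟩

/-- The sink is the last vertex. -/
def snk (k : StatementKind) : Fin k.order := ⟨k.order - 1, Nat.sub_lt k.order_pos one_pos⟩

/-- The edges of the statement graphs, on vertices `0, 1, …, order - 1`. -/
def Edge : StatementKind → ℕ → ℕ → Prop
  | sequence, i, j => i = 0 ∧ j = 1
  | ifThen, i, j => (i = 0 ∧ j = 1) ∨ (i = 0 ∧ j = 2) ∨ (i = 1 ∧ j = 2)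
  | whileDo, i, j => (i = 0 ∧ j = 1) ∨ (i = 1 ∧ j = 0) ∨ (i = 0 ∧ j = 2)
  | repeatUntil, i, j => (i = 0 ∧ j = 1) ∨ (i = 1 ∧ j = 0) ∨ (i = 1 ∧ j = 2)
  | ifThenElse, i, j =>
      (i = 0 ∧ j = 1) ∨ (i = 0 ∧ j = 2) ∨ (i = 1 ∧ j = 3) ∨ (i = 2 ∧ j = 3)
  | pCase p _, i, j => (i = 0 ∧ 1 ≤ j ∧ j ≤ p) ∨ (1 ≤ i ∧ i ≤ p ∧ j = p + 1)

/-- The statement graph of kind `k`. -/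
def toGraph (k : StatementKind) : RootedDigraph.{0} where
  V := Fin k.order
  graph := ⟨fun i j => k.Edge i j⟩
  source := k.src

/-- `type(H)`. -/
def type : StatementKind → ℕ
  | sequence => 2
  | ifThen => 3
  | whileDo => 4
  | repeatUntil => 5
  | ifThenElse => 6
  | pCase p _ => p + 4

end StatementKind

/-- `lex`: the concatenation of the given strings in non-decreasing lexicographic order. -/
def lexConcat (l : List (List ℕ)) : List ℕ := (l.insertionSort (· ≤ ·)).flatten

/-- The code `C(H)` of a statement graph `H` of the given kind whose vertices carry the codes `c`:
the type, then the codes of all vertices but the source. Neighborhoods are taken in `H`.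
With `v` the source, vertex `1` is the element of `N⁺(v)` for a sequence, of `N⁺(v) ∖ N²⁺(v)` for
an if graph, of `N⁺(v) ∩ N⁻(v)` for a while graph and of `N⁺(v)` for a repeat graph; vertex `2`
is the element of `N²⁺(v)`, `N⁺(v) ∖ N⁻(v)`, `N²⁺(v) ∖ {v}` in the last three cases. For an
if-then-else or `p`-case graph all vertices but source and sink form `N⁺(v)`, and the sink
is the only element of `N²⁺(v)`. -/
def StatementKind.code : (k : StatementKind) → (Fin k.order → List ℕ) → List ℕ
  | .sequence, c => 2 :: c ⟨1, by decide⟩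
  | .ifThen, c => 3 :: (c ⟨1, by decide⟩ ++ c ⟨2, by decide⟩)
  | .whileDo, c => 4 :: (c ⟨1, by decide⟩ ++ c ⟨2, by decide⟩)
  | .repeatUntil, c => 5 :: (c ⟨1, by decide⟩ ++ c ⟨2, by decide⟩)
  | .ifThenElse, c =>
      6 :: (lexConcat [c ⟨1, by decide⟩, c ⟨2, by decide⟩] ++ c ⟨3, by decide⟩)
  | .pCase p _, c =>
      (p + 4) :: (lexConcat (List.ofFn fun i : Fin p =>
          c ⟨i.val + 1, by simp only [StatementKind.order]; omega⟩) ++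
        c ⟨p + 1, by simp [StatementKind.order]⟩)

namespace RootedDigraph

/-- The expansion of the vertex `v` of `G` into a statement graph of kind `k`. -/
noncomputable def expand (G : RootedDigraph.{u}) (v : G.V) (k : StatementKind) : RootedDigraph.{u} where
  V := {w : G.V // w ≠ v} ⊕ Fin k.order
  graph := ⟨fun a b => match a, b with
    | .inl x, .inl y => G.Adj x y
    | .inl x, .inr j => G.Adj x v ∧ j = k.src
    | .inr i, .inl y => G.Adj v y ∧ i = k.snk
    | .inr i, .inr j => k.toGraph.Adj i j⟩
  source := by
    classical
    exact if h : G.source = v then .inr k.src else .inl ⟨G.source, h⟩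

/-- The vertices labeled `X` after the expansion of `v`, if `X` is the set of vertices so labeled
before: the source of the statement graph becomes regular, its other vertices are expansible. -/
def expandLabels (G : RootedDigraph.{u}) (X : Set G.V) (v : G.V) (k : StatementKind) :
    Set (G.expand v k).V :=
  {a : {w : G.V // w ≠ v} ⊕ Fin k.order | match a with
    | .inl x => x.val ∈ X
    | .inr i => i ≠ k.src}

/-- `G` with set `X` of expansible vertices is a labeled Dijkstra graph (the vertices outside `X`
are regular). -/
inductive IsLabeledDijkstra : (G : RootedDigraph.{u}) → Set G.V → Prop
  | trivial (G : RootedDigraph.{u}) (hV : ∀ a : G.V, a = G.source)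
      (hE : ∀ a b : G.V, ¬ G.Adj a b) : IsLabeledDijkstra G Set.univ
  | expand (G : RootedDigraph.{u}) (X : Set G.V) (v : G.V) (k : StatementKind) :
      IsLabeledDijkstra G X → v ∈ X → IsLabeledDijkstra (G.expand v k) (G.expandLabels X v k)
  | iso (G G' : RootedDigraph.{u}) (X : Set G.V) (e : G.Iso G') :
      IsLabeledDijkstra G X → IsLabeledDijkstra G' (e.toEquiv '' X)

/-- `G` (without labels) is a Dijkstra graph. -/
def IsDijkstra (G : RootedDigraph.{u}) : Prop := ∃ X : Set G.V, G.IsLabeledDijkstra X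

/-- A prime subgraph `H` of `G`: an induced subgraph that is isomorphic, together with its cycle
edges, to a non-trivial statement graph, and that is closed. It is given by an isomorphism from
the statement graph. -/
structure Prime (G : RootedDigraph.{u}) where
  kind : StatementKind
  emb : Fin kind.order → G.V
  emb_injective : Function.Injective emb
  adj_iff : ∀ i j, G.Adj (emb i) (emb j) ↔ kind.toGraph.Adj i j
  cycleEdge_iff : ∀ i j, G.IsCycleEdge (emb i) (emb j) ↔ kind.toGraph.IsCycleEdge i j
  closed_in : ∀ i, i ≠ kind.src → ∀ w, G.Adj w (emb i) → w ∈ Set.range emb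
  closed_out : ∀ i, i ≠ kind.snk → ∀ w, G.Adj (emb i) w → w ∈ Set.range emb
  closed_cycle : ∀ w, G.IsCycleEdge w (emb kind.src) → G.Adj (emb kind.src) w

namespace Prime

variable {G : RootedDigraph.{u}}

/-- The vertex set `V(H)`. -/
def verts (H : G.Prime) : Set G.V := Set.range H.emb

/-- The source `s(H)`. -/
def src (H : G.Prime) : G.V := H.emb H.kind.src

/-- `H` is a lowest prime subgraph: no other prime subgraph has its source below `s(H)`. -/
def IsLowest (H : G.Prime) : Prop :=
  ∀ H' : G.Prime, H'.verts ≠ H.verts → ¬ G.IsDescendant H.src H'.src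

/-- The code `C(H)`, where `C` gives the current codes of the vertices. -/
def code (H : G.Prime) (C : G.V → List ℕ) : List ℕ := H.kind.code fun i => C (H.emb i)

/-- The vertices that remain when `H` is contracted into `s(H)`. -/
abbrev ContractVert (H : G.Prime) : Type u := {w : G.V // w ∉ H.verts ∨ w = H.src}

open Classical in
/-- The image of a vertex under the contraction of `H`. -/
noncomputable def image (H : G.Prime) (w : G.V) : H.ContractVert :=
  if h : w ∈ H.verts then ⟨H.src, Or.inr rfl⟩ else ⟨w, Or.inl h⟩

/-- The contraction `G ↓ H`: the vertices of `H` are identified with `s(H)`, and parallel edges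
and loops are removed. -/
noncomputable def contract (H : G.Prime) : RootedDigraph.{u} where
  V := H.ContractVert
  graph := ⟨fun a b => a ≠ b ∧ ∃ x y : G.V, G.Adj x y ∧ H.image x = a ∧ H.image y = b⟩
  source := H.image G.source

open Classical in
/-- The vertex codes after the contraction of `H`: `C(s(H)) := C(s(H)) || C(H)`. -/
noncomputable def updateCode (H : G.Prime) (C : G.V → List ℕ) : H.contract.V → List ℕ :=
  fun a : H.ContractVert => if a.val = H.src then C H.src ++ H.code C else C a.val

end Prime

/-- `G.CodeFrom C c`: along some maximal bottom-up contractile sequence that starts at `G`, the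
codes of the vertices being initially given by `C`, the source finally gets the code `c`. -/
inductive CodeFrom : (G : RootedDigraph.{u}) → (G.V → List ℕ) → List ℕ → Prop
  | done (G : RootedDigraph.{u}) (C : G.V → List ℕ) (h : IsEmpty G.Prime) :
      CodeFrom G C (C G.source)
  | step (G : RootedDigraph.{u}) (C : G.V → List ℕ) (H : G.Prime) (hH : H.IsLowest)
      (c : List ℕ) : CodeFrom H.contract (H.updateCode C) c → CodeFrom G C c

/-- `c` is a code of `G` computed from some bottom-up contractile sequence; the code of every
vertex is `1` at the beginning. -/
def IsCode (G : RootedDigraph.{u}) (c : List ℕ) : Prop := G.CodeFrom (fun _ => [1]) c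

end RootedDigraph

end StructuredProgram

set_option linter.unusedSimpArgs false
set_option linter.unnecessarySeqFocus false

/-! A Dijkstra graph is the flow graph of a `Program`: a tree whose inner nodes are the statement
graphs inserted by the expansions and whose leaves are the vertices, addressed by lists of child
indices. The lexicographic order of these addresses replaces depth-first search. An edge that
descends in it enters a vertex dominating its tail, so simple paths from the source climb, and the
cycle edges are exactly the descending edges (`IsReducibleRank.isCycleEdge_iff`).

Uniqueness. Leaves carry codes, so that partially contracted graphs are again flow graphs of
programs. An expansible vertex is never the source of a prime subgraph
(`Program.not_isX_prime_src`), and from every regular vertex the source of some innermost statement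
graph can be reached without cycle edges. Hence a lowest prime subgraph is an innermost statement
graph (`Program.exists_isExpansion_of_isLowest`); since the source of a prime subgraph determines
its vertices and code, contracting it just turns the innermost node into a leaf with the accumulated
code. This preserves `Program.code`, and induction on the number of nodes shows that every
contractile sequence ends with that code (`Program.codeFrom_iff`).

Isomorphism. Contractile sequences can be transported along isomorphisms (`Iso.codeFrom`), so
isomorphic graphs have equal codes. Conversely, every vertex code starts with 1 and every type is at
least 2; after an initial 1 the next symbol therefore tells a vertex from a statement graph, and
codes can be parsed uniquely (`Program.prefixFree_code`). Parsing recovers the tree up to the order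
of the branches of if-then-else and case nodes, and reordering branches is an automorphism of the
statement graph, so equal codes give isomorphic flow graphs (`Program.exists_isIso_of_code_eq`). -/

namespace StructuredProgram

/-! ### Edges of the statement graphs -/

namespace StatementKind

theorem Edge.lt_order {k : StatementKind} {i j : ℕ} (h : k.Edge i j) :
    i < k.order ∧ j < k.order := by
  cases k <;> simp only [Edge, order, true_and, false_and, and_true, and_false,
        true_or, false_or, or_true, or_false] at * <;> omega

theorem Edge.lt_or_eq_zero {k : StatementKind} {i j : ℕ} (h : k.Edge i j) :
    i < j ∨ (j = 0 ∧ 0 < i ∧ k.Edge 0 i) := by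
  cases k <;> simp only [Edge, true_and, false_and, and_true, and_false,
        true_or, false_or, or_true, or_false] at * <;> omega

theorem Edge.ne {k : StatementKind} {i j : ℕ} (h : k.Edge i j) : i ≠ j := by
  rcases h.lt_or_eq_zero with h | h <;> omega

theorem exists_edge_lt (k : StatementKind) {j : ℕ} (h0 : j ≠ 0) (hj : j < k.order) :
    ∃ i < j, k.Edge i j := by
  cases k with
  | pCase p hp =>
    simp only [order] at hj
    by_cases h : j = p + 1
    · exact ⟨1, by omega, by simp only [Edge, true_and, false_and, and_true, and_false,
          true_or, false_or, or_true, or_false] <;> omega⟩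
    · exact ⟨0, by omega, by simp only [Edge, true_and, false_and, and_true, and_false,
          true_or, false_or, or_true, or_false] <;> omega⟩
  | ifThenElse =>
    simp only [order] at hj
    by_cases h : j = 3
    · exact ⟨1, by omega, by simp only [Edge, true_and, false_and, and_true, and_false,
          true_or, false_or, or_true, or_false] <;> omega⟩
    · exact ⟨0, by omega, by simp only [Edge, true_and, false_and, and_true, and_false,
          true_or, false_or, or_true, or_false] <;> omega⟩
  | repeatUntil =>
    exact ⟨j - 1, by omega, by simp only [order, Edge, true_and, false_and, and_true, and_false,
        true_or, false_or, or_true, or_false] at * <;> omega⟩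
  | _ =>
    exact ⟨0, by omega, by simp only [order, Edge, true_and, false_and, and_true, and_false,
        true_or, false_or, or_true, or_false] at * <;> omega⟩

theorem two_le_order (k : StatementKind) : 2 ≤ k.order := by
  cases k <;> simp only [order] <;> omega

/-- Unless `i` ends the body of a loop, the source reaches every out-neighbor of `i` by a path of
length at most two that avoids `i`. -/
theorem Edge.exists_detour {k : StatementKind} {i j : ℕ} (h : k.Edge i j) (hi : i ≠ 0)
    (hb : ¬ k.Edge i 0) : k.Edge 0 j ∨ ∃ l, l ≠ i ∧ k.Edge 0 l ∧ k.Edge l j := by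
  cases k with
  | pCase p hp =>
    right
    -- The detour to the sink takes another branch: branch 1, or branch 2 if `i` is branch 1 itself.
    by_cases h1 : i = 1
    · refine ⟨2, by omega, ?_⟩
      simp only [Edge, true_and, false_and, and_true, and_false,
            true_or, false_or, or_true, or_false] at * <;> omega
    · refine ⟨1, by omega, ?_⟩
      simp only [Edge, true_and, false_and, and_true, and_false,
            true_or, false_or, or_true, or_false] at * <;> omega
  | ifThenElse =>
    right
    by_cases h1 : i = 1
    · refine ⟨2, by omega, ?_⟩
      simp only [Edge, true_and, false_and, and_true, and_false,
            true_or, false_or, or_true, or_false] at * <;> omega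
    · refine ⟨1, by omega, ?_⟩
      simp only [Edge, true_and, false_and, and_true, and_false,
            true_or, false_or, or_true, or_false] at * <;> omega
  | _ => left; simp only [Edge, true_and, false_and, and_true, and_false,
        true_or, false_or, or_true, or_false] at * <;> omega

/-- The second alternative is for the sink of a repeat, if-then-else or case graph, which every
out-neighbor of the source precedes. The bound on the order excludes the sequence when prime
subgraphs with a common source are compared. -/
theorem edge_zero_or_forall (k : StatementKind) {i : ℕ} (hi : i ≠ 0) (hk : i < k.order) :
    k.Edge 0 i ∨ ∀ l, k.Edge 0 l → k.Edge l i ∧ (k.order ≠ 2) := by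
  cases k with
  | pCase p hp =>
    simp only [order, Edge, true_and, false_and, and_true, and_false,
          true_or, false_or, or_true, or_false] at *
    by_cases h : i = p + 1
    · right; intro l hl; omega
    · left; omega
  | ifThenElse =>
    simp only [order, Edge, true_and, false_and, and_true, and_false,
          true_or, false_or, or_true, or_false] at *
    by_cases h : i = 3
    · right; intro l hl; omega
    · left; omega
  | repeatUntil =>
    simp only [order, Edge, true_and, false_and, and_true, and_false,
          true_or, false_or, or_true, or_false] at *
    by_cases h : i = 2
    · right; intro l hl; omega
    · left; omega
  | _ => left; simp only [order, Edge, true_and, false_and, and_true, and_false,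
        true_or, false_or, or_true, or_false] at * <;> omega

end StatementKind

/-! ### Depth-first search, simple paths and cycle edges -/

namespace RootedDigraph

/-- A simple path from the source, listed backwards. -/
inductive SimplePath (G : RootedDigraph.{u}) : List G.V → Prop
  | single : SimplePath G [G.source]
  | cons {v w : G.V} {l : List G.V} : SimplePath G (v :: l) → G.Adj v w → w ∉ v :: l →
      SimplePath G (w :: v :: l)

variable {G : RootedDigraph.{u}}

theorem DFSState.subset {s : List G.V} {vis : Set G.V} (h : G.DFSState s vis) :
    ∀ x ∈ s, x ∈ vis := by
  induction h with
  | start => simp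
  | push _ _ _ ih =>
    intro x hx
    rcases List.mem_cons.1 hx with rfl | hx
    · exact Set.mem_insert _ _
    · exact Set.mem_insert_of_mem _ (ih x hx)
  | pop _ _ ih => exact fun x hx => ih x (List.mem_cons_of_mem _ hx)

theorem DFSState.simplePath {s : List G.V} {vis : Set G.V} (h : G.DFSState s vis) :
    s = [] ∨ G.SimplePath s := by
  induction h with
  | start => exact Or.inr .single
  | push h ha hw ih =>
    refine Or.inr (.cons (ih.resolve_left (by simp)) ha fun hm => hw (h.subset _ hm))
  | pop h _ ih =>
    rcases ih.resolve_left (by simp) with _ | ⟨h', _, _⟩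
    · exact Or.inl rfl
    · exact Or.inr h'

theorem SimplePath.dfsState {s : List G.V} (h : G.SimplePath s) : G.DFSState s {x | x ∈ s} := by
  induction h with
  | single => simpa using DFSState.start (G := G)
  | @cons v w l h ha hw ih =>
    have := DFSState.push ih ha hw
    convert this using 1
    ext x; simp

/-- The stack of a search is always a simple path from the source, and each such path is the stack
of the search that pushes its vertices one after the other. -/
theorem isCycleEdge_iff {v w : G.V} :
    G.IsCycleEdge v w ↔ G.Adj v w ∧ ∃ l, G.SimplePath (v :: l) ∧ w ∈ l :=
  ⟨fun ⟨h, l, _, hl, hw⟩ => ⟨h, l, hl.simplePath.resolve_left (by simp), hw⟩,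
    fun ⟨h, l, hl, hw⟩ => ⟨h, l, _, hl.dfsState, hw⟩⟩

/-- A path that ends in `D` starts in `D` or enters it at some moment, and both can happen only at
`q`. -/
theorem SimplePath.mem_of_entry {s : List G.V} (h : G.SimplePath s) {D : Set G.V} {q : G.V}
    (hs : G.source ∈ D → G.source = q) (hD : ∀ x ∉ D, ∀ y ∈ D, G.Adj x y → y = q) :
    ∀ a l, s = a :: l → a ∈ D → q ∈ s := by
  induction h with
  | single => rintro a l ⟨⟩ ha; simp [hs ha]
  | @cons v w l' h ha hw ih =>
    rintro a l ⟨⟩ haD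
    by_cases hv : v ∈ D
    · exact List.mem_cons_of_mem _ (ih _ _ rfl hv)
    · simp [hD v hv w haD ha]

/-- A ranking of the vertices such that every edge that goes down enters a vertex that
dominates its tail. -/
structure IsReducibleRank (G : RootedDigraph.{u}) {α : Type*} [LinearOrder α] (r : G.V → α) :
    Prop where
  ne : ∀ p q, G.Adj p q → r p ≠ r q
  dom : ∀ p q, G.Adj p q → r q < r p → ∃ D : Set G.V, p ∈ D ∧ (G.source ∈ D → G.source = q) ∧
    ∀ x ∉ D, ∀ y ∈ D, G.Adj x y → y = q
  reach : ∀ p, Relation.ReflTransGen (fun x y => G.Adj x y ∧ r x < r y) G.source p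

namespace IsReducibleRank

variable {α : Type*} [LinearOrder α] {r : G.V → α}

/-- A descending edge cannot extend a simple path: its head dominates its tail and so has been
visited already. -/
theorem simplePath_lt (hr : G.IsReducibleRank r) {s : List G.V} (h : G.SimplePath s) :
    ∀ a l, s = a :: l → ∀ b ∈ l, r b < r a := by
  induction h with
  | single => rintro a l ⟨⟩; simp
  | @cons v w l' h ha hw ih =>
    rintro a l ⟨⟩
    have hvw : r v < r w := by
      refine (hr.ne _ _ ha).lt_or_gt.resolve_right fun hlt => ?_
      obtain ⟨D, hv, hs, hD⟩ := hr.dom _ _ ha hlt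
      exact hw (h.mem_of_entry hs hD _ _ rfl hv)
    intro b hb
    rcases List.mem_cons.1 hb with rfl | hb
    · exact hvw
    · exact (ih _ _ rfl b hb).trans hvw

theorem exists_simplePath (hr : G.IsReducibleRank r) (p : G.V) : ∃ l, G.SimplePath (p :: l) := by
  induction hr.reach p with
  | refl => exact ⟨[], .single⟩
  | @tail b c _ hbc ih =>
    obtain ⟨l, hl⟩ := ih
    refine ⟨b :: l, .cons hl hbc.1 fun hc => ?_⟩
    rcases List.mem_cons.1 hc with rfl | hc
    · exact lt_irrefl _ hbc.2
    · exact lt_asymm hbc.2 (hr.simplePath_lt hl _ _ rfl _ hc)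

theorem isCycleEdge_iff (hr : G.IsReducibleRank r) {p q : G.V} :
    G.IsCycleEdge p q ↔ G.Adj p q ∧ r q < r p := by
  rw [RootedDigraph.isCycleEdge_iff]
  refine and_congr_right fun ha => ⟨fun ⟨l, hl, hq⟩ => hr.simplePath_lt hl _ _ rfl _ hq,
    fun hlt => ?_⟩
  obtain ⟨l, hl⟩ := hr.exists_simplePath p
  obtain ⟨D, hp, hs, hD⟩ := hr.dom _ _ ha hlt
  refine ⟨l, hl, (List.mem_cons.1 (hl.mem_of_entry hs hD _ _ rfl hp)).resolve_left ?_⟩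
  rintro rfl
  exact lt_irrefl _ hlt

theorem not_isCycleEdge_iff (hr : G.IsReducibleRank r) {p q : G.V} :
    (G.Adj p q ∧ ¬ G.IsCycleEdge p q) ↔ G.Adj p q ∧ r p < r q := by
  rw [hr.isCycleEdge_iff]
  refine and_congr_right fun h => ?_
  rw [not_and, not_lt]
  exact ⟨fun h' => lt_of_le_of_ne (h' h) (hr.ne _ _ h), fun h' _ => h'.le⟩

end IsReducibleRank

end RootedDigraph

namespace StatementKind

/-- The only descending edges close loops at the source, for which the whole vertex set serves as
region. -/
theorem isReducibleRank (k : StatementKind) :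
    k.toGraph.IsReducibleRank (fun i : Fin k.order => i) where
  ne p q h e := Edge.ne h (congrArg Fin.val e)
  dom p q h hlt := by
    refine ⟨Set.univ, trivial, fun _ => ?_, fun x hx => (hx trivial).elim⟩
    rcases Edge.lt_or_eq_zero h with h | h
    · exact absurd h (not_lt.2 (le_of_lt hlt))
    · exact Fin.ext h.1.symm
  reach := by
    suffices H : ∀ n (hn : n < k.order), Relation.ReflTransGen
        (fun x y : Fin k.order => k.toGraph.Adj x y ∧ x < y) k.src ⟨n, hn⟩ from
      fun p => H p.1 p.2
    intro n
    induction n using Nat.strong_induction_on with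
    | _ n ih =>
      intro hn
      by_cases h0 : n = 0
      · subst h0; exact .refl
      · obtain ⟨i, hi, he⟩ := k.exists_edge_lt h0 hn
        exact (ih i hi (hi.trans hn)).tail ⟨he, hi⟩

end StatementKind

/-! ### Transport of contractions and codes along isomorphisms -/

namespace RootedDigraph

theorem Prime.image_eq_iff {G : RootedDigraph.{u}} (P : G.Prime) (x : G.V) (a : P.ContractVert) :
    P.image x = a ↔ (x ∈ P.verts ∧ a.1 = P.src) ∨ (x ∉ P.verts ∧ a.1 = x) := by
  unfold Prime.image
  split_ifs with h
  · simp [h, Subtype.ext_iff, eq_comm]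
  · simp [h, Subtype.ext_iff, eq_comm]

namespace Iso

variable {G : RootedDigraph.{u}} {H : RootedDigraph.{v}}

/-- The inverse isomorphism. -/
def symm (e : G.Iso H) : H.Iso G where
  toEquiv := e.toEquiv.symm
  map_adj a b := by rw [e.map_adj, Equiv.apply_symm_apply, Equiv.apply_symm_apply]
  map_source := by rw [Equiv.symm_apply_eq, e.map_source]

/-- The composition of two isomorphisms. -/
def trans {K : RootedDigraph} (e : G.Iso H) (f : H.Iso K) : G.Iso K where
  toEquiv := e.toEquiv.trans f.toEquiv
  map_adj a b := by rw [e.map_adj, f.map_adj]; rfl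
  map_source := by rw [Equiv.trans_apply, e.map_source, f.map_source]

theorem adj_symm (e : G.Iso H) {a b : H.V} :
    G.Adj (e.toEquiv.symm a) (e.toEquiv.symm b) ↔ H.Adj a b := (e.symm.map_adj a b).symm

theorem simplePath (e : G.Iso H) {l : List G.V} (h : G.SimplePath l) :
    H.SimplePath (l.map e.toEquiv) := by
  induction h with
  | single => simpa [e.map_source] using SimplePath.single (G := H)
  | cons h ha hw ih =>
    refine .cons ih ((e.map_adj _ _).1 ha) ?_
    rwa [← List.map_cons (f := e.toEquiv), List.mem_map_of_injective e.toEquiv.injective]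

theorem isCycleEdge (e : G.Iso H) {v w : G.V} (h : G.IsCycleEdge v w) :
    H.IsCycleEdge (e.toEquiv v) (e.toEquiv w) := by
  rw [isCycleEdge_iff] at *
  obtain ⟨ha, l, hl, hw⟩ := h
  exact ⟨(e.map_adj _ _).1 ha, l.map e.toEquiv, e.simplePath hl, List.mem_map_of_mem hw⟩

theorem map_isCycleEdge (e : G.Iso H) {v w : G.V} :
    G.IsCycleEdge v w ↔ H.IsCycleEdge (e.toEquiv v) (e.toEquiv w) :=
  ⟨e.isCycleEdge, fun h => by simpa [symm] using e.symm.isCycleEdge h⟩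

theorem isDescendant (e : G.Iso H) {v w : G.V} (h : G.IsDescendant v w) :
    H.IsDescendant (e.toEquiv v) (e.toEquiv w) := by
  unfold IsDescendant at *
  refine Relation.ReflTransGen.lift e.toEquiv (fun a b hab => ?_) v w h
  exact ⟨(e.map_adj a b).1 hab.1, fun h => hab.2 (e.map_isCycleEdge.2 h)⟩

/-- The image of a prime subgraph under an isomorphism. -/
def prime (e : G.Iso H) (P : G.Prime) : H.Prime where
  kind := P.kind
  emb := e.toEquiv ∘ P.emb
  emb_injective := e.toEquiv.injective.comp P.emb_injective
  adj_iff i j := by rw [← P.adj_iff, e.map_adj]; rfl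
  cycleEdge_iff i j := by rw [← P.cycleEdge_iff, e.map_isCycleEdge]; rfl
  closed_in i hi w hw := by
    obtain ⟨j, hj⟩ := P.closed_in i hi (e.toEquiv.symm w) (by rw [e.map_adj]; simpa using hw)
    exact ⟨j, by simp [hj]⟩
  closed_out i hi w hw := by
    obtain ⟨j, hj⟩ := P.closed_out i hi (e.toEquiv.symm w) (by rw [e.map_adj]; simpa using hw)
    exact ⟨j, by simp [hj]⟩
  closed_cycle w hw := by
    have := P.closed_cycle (e.toEquiv.symm w) (by rw [e.map_isCycleEdge]; simpa using hw)
    rw [e.map_adj] at this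
    simpa using this

@[simp] theorem prime_src (e : G.Iso H) (P : G.Prime) : (e.prime P).src = e.toEquiv P.src := rfl

theorem prime_verts (e : G.Iso H) (P : G.Prime) : (e.prime P).verts = e.toEquiv '' P.verts :=
  Set.range_comp e.toEquiv P.emb

theorem mem_prime_verts (e : G.Iso H) (P : G.Prime) (w : G.V) :
    e.toEquiv w ∈ (e.prime P).verts ↔ w ∈ P.verts := by
  rw [prime_verts, e.toEquiv.injective.mem_set_image]

theorem prime_isLowest (e : G.Iso H) {P : G.Prime} (h : P.IsLowest) : (e.prime P).IsLowest := by
  intro Q hQ hd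
  refine h (e.symm.prime Q) (fun hv => hQ ?_) (by simpa [symm] using e.symm.isDescendant hd)
  rw [prime_verts, ← hv, prime_verts, ← Set.image_comp]
  convert Set.image_id _
  ext x
  simp [symm]

/-- The bijection between the vertices of corresponding contractions. -/
def contractEquiv (e : G.Iso H) (P : G.Prime) : P.ContractVert ≃ (e.prime P).ContractVert :=
  e.toEquiv.subtypeEquiv fun a => by rw [mem_prime_verts, prime_src, e.toEquiv.apply_eq_iff_eq]

@[simp] theorem coe_contractEquiv (e : G.Iso H) (P : G.Prime) (a : P.ContractVert) :
    (e.contractEquiv P a).1 = e.toEquiv a.1 := rfl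

theorem prime_image_eq_iff (e : G.Iso H) (P : G.Prime) (x : G.V) (a : P.ContractVert) :
    (e.prime P).image (e.toEquiv x) = e.contractEquiv P a ↔ P.image x = a := by
  simp [Prime.image_eq_iff, mem_prime_verts]

/-- An isomorphism induces one between the contractions of corresponding prime subgraphs. -/
noncomputable def contract (e : G.Iso H) (P : G.Prime) : P.contract.Iso (e.prime P).contract where
  toEquiv := e.contractEquiv P
  map_adj a b := by
    refine and_congr (e.contractEquiv P).injective.ne_iff.symm ⟨?_, ?_⟩
    · rintro ⟨x, y, hxy, hx, hy⟩
      exact ⟨e.toEquiv x, e.toEquiv y, (e.map_adj _ _).1 hxy, (e.prime_image_eq_iff P x a).2 hx,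
        (e.prime_image_eq_iff P y b).2 hy⟩
    · rintro ⟨x, y, hxy, hx, hy⟩
      obtain ⟨x, rfl⟩ := e.toEquiv.surjective x
      obtain ⟨y, rfl⟩ := e.toEquiv.surjective y
      exact ⟨x, y, (e.map_adj _ _).2 hxy, (e.prime_image_eq_iff P x a).1 hx,
        (e.prime_image_eq_iff P y b).1 hy⟩
  map_source := by
    refine ((e.prime_image_eq_iff P G.source _).2 rfl).symm.trans ?_
    rw [e.map_source]
    rfl

open Classical in
theorem updateCode_prime (e : G.Iso H) (P : G.Prime) (C : G.V → List ℕ) :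
    (e.prime P).updateCode (C ∘ e.toEquiv.symm) =
      P.updateCode C ∘ (e.contract P).toEquiv.symm := by
  rw [Equiv.eq_comp_symm]
  funext a
  have hc : (e.prime P).code (C ∘ e.toEquiv.symm) = P.code C := by
    simp [Prime.code, prime]
  change (if e.toEquiv a.1 = e.toEquiv P.src
    then C (e.toEquiv.symm (e.toEquiv P.src)) ++ (e.prime P).code (C ∘ e.toEquiv.symm)
    else C (e.toEquiv.symm (e.toEquiv a.1))) = P.updateCode C a
  simp only [hc, e.toEquiv.apply_eq_iff_eq, Equiv.symm_apply_apply, Prime.updateCode]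

/-- The target may lie in another universe, since flow graphs of programs live in universe 0. -/
theorem codeFrom {G : RootedDigraph.{u}} {C : G.V → List ℕ} {c : List ℕ} (h : G.CodeFrom C c) :
    ∀ (H : RootedDigraph.{v}) (e : G.Iso H), H.CodeFrom (C ∘ e.toEquiv.symm) c := by
  induction h with
  | done G C hG =>
    intro H e
    have := CodeFrom.done H (C ∘ e.toEquiv.symm) ⟨fun P => hG.elim (e.symm.prime P)⟩
    rwa [← e.map_source, Function.comp_apply, Equiv.symm_apply_apply] at this
  | step G C P hP c _ ih =>
    intro H e
    refine .step H _ (e.prime P) (e.prime_isLowest hP) c ?_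
    rw [updateCode_prime]
    exact ih _ (e.contract P)

theorem isCode (e : G.Iso H) {c : List ℕ} (h : G.IsCode c) : H.IsCode c := codeFrom h H e

/-- An isomorphism induces one between the expansions of corresponding vertices. -/
noncomputable def expand (e : G.Iso H) (v : G.V) (k : StatementKind) :
    (G.expand v k).Iso (H.expand (e.toEquiv v) k) where
  toEquiv := Equiv.sumCongr (e.toEquiv.subtypeEquiv fun a => by simp) (Equiv.refl _)
  map_adj a b := by
    rcases a with a | a <;> rcases b with b | b
    · exact e.map_adj _ _
    · exact and_congr (e.map_adj _ _) Iff.rfl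
    · exact and_congr (e.map_adj _ _) Iff.rfl
    · exact Iff.rfl
  map_source := by
    unfold RootedDigraph.expand
    by_cases h : G.source = v
    · have h' : H.source = e.toEquiv v := by rw [← h, e.map_source]
      rw [dif_pos h, dif_pos h']
      rfl
    · have h' : H.source ≠ e.toEquiv v := by
        rw [← e.map_source]; exact e.toEquiv.injective.ne h
      rw [dif_neg h, dif_neg h']
      exact congrArg Sum.inl (Subtype.ext e.map_source)

end Iso

/-- The projection of an expansion of `G` to `G`. -/
def expandProj (G : RootedDigraph.{u}) (p : G.V) (k : StatementKind) : (G.expand p k).V → G.V :=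
  Sum.elim Subtype.val fun _ => p

theorem expandProj_source (G : RootedDigraph.{u}) (p : G.V) (k : StatementKind) :
    G.expandProj p k (G.expand p k).source = G.source := by
  unfold expand
  by_cases h : G.source = p
  · simp [expandProj, h]
  · simp [expandProj, h]

theorem exists_expand_adj {G : RootedDigraph.{u}} (p : G.V) (k : StatementKind) {a b : G.V}
    (hp : ¬ G.Adj p p) (h : G.Adj a b) :
    ∃ x y, (G.expand p k).Adj x y ∧ G.expandProj p k x = a ∧ G.expandProj p k y = b := by
  by_cases ha : a = p
  · subst ha
    have hb : b ≠ a := by rintro rfl; exact hp h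
    exact ⟨.inr k.snk, .inl ⟨b, hb⟩, ⟨h, rfl⟩, rfl, rfl⟩
  · by_cases hb : b = p
    · subst hb
      exact ⟨.inl ⟨a, ha⟩, .inr k.src, ⟨h, rfl⟩, rfl, rfl⟩
    · exact ⟨.inl ⟨a, ha⟩, .inl ⟨b, hb⟩, h, rfl, rfl⟩

/-- The contraction of the statement graph inserted by an expansion. -/
theorem Prime.exists_iso_of_expand {G : RootedDigraph.{u}} {G₀ : RootedDigraph.{v}}
    {p : G₀.V} {k : StatementKind} (hG₀ : ∀ a, ¬ G₀.Adj a a) (e : G.Iso (G₀.expand p k))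
    (P : G.Prime) (hv : ∀ x, x ∈ P.verts ↔ ∃ i : Fin k.order, e.toEquiv x = Sum.inr i) :
    ∃ f : P.contract.Iso G₀,
      ∀ a : P.ContractVert, f.toEquiv a = G₀.expandProj p k (e.toEquiv a.1) := by
  set F : G.V → G₀.V := fun x => G₀.expandProj p k (e.toEquiv x) with hF
  have hin : ∀ x ∈ P.verts, F x = p := by
    intro x hx
    obtain ⟨i, hi⟩ := (hv x).1 hx
    simp only [hF]
    rw [hi]
    rfl
  have hout : ∀ x ∉ P.verts, ∃ w : {w : G₀.V // w ≠ p}, e.toEquiv x = Sum.inl w ∧ F x = w.1 := by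
    intro x hx
    rcases hi : e.toEquiv x with w | i
    · exact ⟨w, rfl, by simp only [hF]; rw [hi]; rfl⟩
    · exact (hx ((hv x).2 ⟨i, hi⟩)).elim
  have hsrc : P.src ∈ P.verts := ⟨_, rfl⟩
  -- `F` collapses the statement graph to `p`, so it does not notice the contraction. On the
  -- remaining vertices it is a bijection, through which the edges can be compared.
  have himg : ∀ x, F (P.image x).1 = F x := by
    intro x
    rcases (P.image_eq_iff x _).1 rfl with h | h
    · rw [h.2, hin _ hsrc, hin _ h.1]
    · rw [h.2]
  have hinj : Function.Injective fun a : P.ContractVert => F a.1 := by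
    intro a b hab
    simp only at hab
    have key : ∀ c : P.ContractVert, c.1 ∈ P.verts → c.1 = P.src := fun c hc =>
      c.2.resolve_left (not_not.2 hc)
    by_cases ha : a.1 ∈ P.verts <;> by_cases hb : b.1 ∈ P.verts
    · exact Subtype.ext ((key a ha).trans (key b hb).symm)
    · obtain ⟨w, _, hw⟩ := hout _ hb
      exact (w.2 (by rw [← hw, ← hab, hin _ ha])).elim
    · obtain ⟨w, _, hw⟩ := hout _ ha
      exact (w.2 (by rw [← hw, hab, hin _ hb])).elim
    · obtain ⟨w, hw, hw'⟩ := hout _ ha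
      obtain ⟨z, hz, hz'⟩ := hout _ hb
      have : w = z := Subtype.ext (by rw [← hw', ← hz', hab])
      exact Subtype.ext (e.toEquiv.injective (by rw [hw, hz, this]))
  have hsurj : Function.Surjective fun a : P.ContractVert => F a.1 := by
    intro y
    obtain ⟨x, hx⟩ : ∃ x, F x = y := by
      by_cases hy : y = p
      · exact ⟨P.src, by rw [hin _ hsrc, hy]⟩
      · refine ⟨e.toEquiv.symm (Sum.inl ⟨y, hy⟩), ?_⟩
        simp only [hF]
        erw [Equiv.apply_symm_apply]
        rfl
    exact ⟨P.image x, (himg x).trans hx⟩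
  refine ⟨⟨Equiv.ofBijective _ ⟨hinj, hsurj⟩, fun a b => ?_, ?_⟩, fun a => rfl⟩
  · change (a ≠ b ∧ ∃ x y, G.Adj x y ∧ P.image x = a ∧ P.image y = b) ↔ G₀.Adj (F a.1) (F b.1)
    constructor
    · rintro ⟨hab, x, y, hxy, rfl, rfl⟩
      rw [himg, himg]
      have h := (e.map_adj _ _).1 hxy
      by_cases hx : x ∈ P.verts <;> by_cases hy : y ∈ P.verts
      · refine (hab ?_).elim
        refine (P.image_eq_iff x (P.image y)).2 ?_
        exact Or.inl ⟨hx, (((P.image_eq_iff y _).1 rfl).resolve_right fun h => h.1 hy).2⟩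
      · obtain ⟨i, hi⟩ := (hv x).1 hx
        obtain ⟨w, hw, hw'⟩ := hout _ hy
        rw [hi, hw] at h
        rw [hin x hx, hw']
        exact h.1
      · obtain ⟨i, hi⟩ := (hv y).1 hy
        obtain ⟨w, hw, hw'⟩ := hout _ hx
        rw [hi, hw] at h
        rw [hin y hy, hw']
        exact h.1
      · obtain ⟨w, hw, hw'⟩ := hout _ hx
        obtain ⟨z, hz, hz'⟩ := hout _ hy
        rw [hw, hz] at h
        rw [hw', hz']
        exact h
    · intro h
      refine ⟨fun hab => hG₀ _ (hab ▸ h), ?_⟩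
      obtain ⟨x, y, hxy, hx, hy⟩ := exists_expand_adj p k (hG₀ p) h
      refine ⟨e.toEquiv.symm x, e.toEquiv.symm y, e.adj_symm.2 hxy, hinj ?_, hinj ?_⟩
      · simp only [himg]
        simp only [hF, Equiv.apply_symm_apply]
        exact hx
      · simp only [himg]
        simp only [hF, Equiv.apply_symm_apply]
        exact hy
  · change F (P.image G.source).1 = _
    rw [himg]
    simp only [hF, e.map_source]
    exact expandProj_source _ _ _

end RootedDigraph

/-! ### Codes of statement graphs, and prime subgraphs with a common source -/

theorem lexConcat_perm {l l' : List (List ℕ)} (h : l.Perm l') : lexConcat l = lexConcat l' := by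
  unfold lexConcat
  congr 1
  exact ((List.perm_insertionSort _ l).trans
    (h.trans (List.perm_insertionSort _ l').symm)).eq_of_pairwise
    (fun _ _ _ _ => le_antisymm) (List.pairwise_insertionSort _ _) (List.pairwise_insertionSort _ _)

namespace StatementKind

theorem edge_zero_one (k : StatementKind) : k.Edge 0 1 := by
  cases k <;> simp [Edge] <;> omega

theorem edge_one_zero_of_unique {k : StatementKind} (h : ∀ l, k.Edge 0 l → l = 1)
    (h2 : k.order ≠ 2) : k.Edge 1 0 := by
  have h := h 2
  cases k <;> simp [Edge, order] at * <;> omega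

theorem not_edge_one_zero {k : StatementKind} (h2 : k.order = 2) : ¬ k.Edge 1 0 := by
  cases k <;> simp [Edge, order] at *

theorem src_ne_snk (k : StatementKind) : k.src ≠ k.snk := by
  have := k.two_le_order
  simp only [src, snk, ne_eq, Fin.mk.injEq]
  omega

theorem exists_edge_to_zero_iff (k : StatementKind) :
    (∃ j, k.Edge j 0) ↔ k = whileDo ∨ k = repeatUntil := by
  cases k <;> simp [Edge]

theorem out_zero_unique_iff (k : StatementKind) :
    (∀ l l', k.Edge 0 l → k.Edge 0 l' → l = l') ↔ k = sequence ∨ k = repeatUntil := by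
  constructor
  · intro h
    have h := h 1 2 k.edge_zero_one
    cases k <;> simp [Edge] at * <;> omega
  · rintro (rfl | rfl) <;> simp only [Edge] <;> omega

/-- The order separates all kinds but if, while and repeat. An edge into the source distinguishes
the loops from the if graph, and a unique out-neighbor of the source distinguishes repeat from
while. -/
theorem eq_of_order_eq {k k' : StatementKind} (ho : k.order = k'.order)
    (h₁ : (∃ j, k.Edge j 0) ↔ ∃ j, k'.Edge j 0)
    (h₂ : (∀ l l', k.Edge 0 l → k.Edge 0 l' → l = l') ↔
      ∀ l l', k'.Edge 0 l → k'.Edge 0 l' → l = l') : k = k' := by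
  rw [exists_edge_to_zero_iff, exists_edge_to_zero_iff] at h₁
  rw [out_zero_unique_iff, out_zero_unique_iff] at h₂
  cases k <;> cases k' <;> simp [order] at * <;> omega

theorem exists_perm_of_fix {p : ℕ} {σ : Fin (p + 2) → Fin (p + 2)} (hσ : σ.Injective)
    (h0 : σ 0 = 0) (hl : σ (Fin.last _) = Fin.last _) :
    ∃ τ : Equiv.Perm (Fin p), ∀ i, σ i.castSucc.succ = (τ i).castSucc.succ := by
  have h : ∀ i : Fin p, ∃ j : Fin p, σ i.castSucc.succ = j.castSucc.succ := by
    intro i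
    have h1 : (σ i.castSucc.succ).1 ≠ 0 := fun h =>
      absurd (hσ ((Fin.ext h : σ i.castSucc.succ = 0).trans h0.symm)) (by simp)
    have h2 : (σ i.castSucc.succ).1 ≠ p + 1 := fun h =>
      absurd (hσ ((Fin.ext h : σ i.castSucc.succ = Fin.last _).trans hl.symm))
        (by simp only [Fin.ext_iff, Fin.val_succ, Fin.val_castSucc, Fin.val_last]; omega)
    have h3 := (σ i.castSucc.succ).2
    refine ⟨⟨(σ i.castSucc.succ).1 - 1, by omega⟩, Fin.ext ?_⟩
    simp only [Fin.val_succ, Fin.val_castSucc]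
    omega
  choose τ hτ using h
  have hinj : τ.Injective := fun i j hij => by
    have := hσ ((hτ i).trans ((congrArg (fun t : Fin p => t.castSucc.succ) hij).trans (hτ j).symm))
    simpa [Fin.ext_iff] using this
  exact ⟨Equiv.ofBijective τ (Finite.injective_iff_bijective.1 hinj), hτ⟩

/-- The code of a statement graph is invariant under automorphisms. -/
theorem code_comp (k : StatementKind) {σ : Fin k.order → Fin k.order} (hσ : σ.Injective)
    (h0 : σ k.src = k.src) (he : ∀ i j : Fin k.order, k.Edge i j ↔ k.Edge (σ i) (σ j))
    (c : Fin k.order → List ℕ) : k.code (c ∘ σ) = k.code c := by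
  have hne : ∀ i j : Fin k.order, i.1 ≠ j.1 → (σ i).1 ≠ (σ j).1 := fun i j h h' =>
    h (congrArg Fin.val (hσ (Fin.ext h')))
  have h0' : (σ ⟨0, k.order_pos⟩).1 = 0 := congrArg Fin.val h0
  -- Used for if-then-else and case graphs: the sink is the only vertex besides the source that is
  -- not an out-neighbor of the source, so `σ` fixes it and permutes the `p` branches.
  have fan : ∀ p (f : ∀ i : Fin (p + 2), Fin k.order) (hk : k.order = p + 2)
      (hf : ∀ i, (f i).1 = i.1)
      (hE : ∀ i, k.Edge 0 i ↔ 1 ≤ i ∧ i ≤ p), ∃ τ : Equiv.Perm (Fin p),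
      (∀ i, σ (f i.castSucc.succ) = f (τ i).castSucc.succ) ∧
        σ (f (Fin.last _)) = f (Fin.last _) := by
    intro p f hk hf hE
    have hl : (σ (f (Fin.last _))).1 = p + 1 := by
      have h1 := (he ⟨0, k.order_pos⟩ (f (Fin.last _)))
      rw [h0', hE, hE, hf, Fin.val_last] at h1
      have h2 := hne (f (Fin.last _)) ⟨0, k.order_pos⟩ (by simp [hf])
      have h3 := (σ (f (Fin.last _))).2
      omega
    let g : Fin (p + 2) → Fin (p + 2) := fun i => ⟨(σ (f i)).1, hk ▸ (σ (f i)).2⟩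
    have hg : ∀ i, σ (f i) = f (g i) := fun i => Fin.ext (hf (g i)).symm
    obtain ⟨τ, hτ⟩ := exists_perm_of_fix (σ := g) (fun i j hij => by
        have := hσ (Fin.ext (by simpa [g] using hij) : σ (f i) = σ (f j))
        have := congrArg Fin.val this
        rw [hf, hf] at this
        exact Fin.ext this)
      (Fin.ext (by
        have : f 0 = ⟨0, k.order_pos⟩ := Fin.ext (hf 0)
        simp only [g, this, h0']; rfl))
      (Fin.ext (by simp only [g, hl]; rfl))
    exact ⟨τ, fun i => by rw [hg, hτ], Fin.ext (by rw [hl, hf]; rfl)⟩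
  cases k with
  | sequence =>
    have h1 : σ ⟨1, by decide⟩ = ⟨1, by decide⟩ := Fin.ext (by
      have h1 := hne ⟨1, by decide⟩ ⟨0, by decide⟩ (by simp)
      have h3 := (σ ⟨1, by decide⟩).2
      simp only [order] at *
      omega)
    simp only [code, Function.comp_apply, h1]
  | ifThenElse =>
    obtain ⟨τ, h1, h2⟩ := fan 2 id rfl (fun _ => rfl) (fun i => by simp [Edge]; omega)
    have := τ.ofFn_comp_perm (fun i : Fin 2 => c i.castSucc.succ)
    have e : (List.ofFn ((fun i : Fin 2 => c i.castSucc.succ) ∘ τ)) =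
        [c (σ ⟨1, by decide⟩), c (σ ⟨2, by decide⟩)] := by
      rw [List.ofFn_succ, List.ofFn_succ, List.ofFn_zero]
      congr 1
      · exact congrArg c (h1 0).symm
      · congr 1
        exact congrArg c (h1 1).symm
    rw [e] at this
    have h2' : σ ⟨3, by decide⟩ = ⟨3, by decide⟩ := h2
    simp only [code, Function.comp_apply, h2', lexConcat_perm this]
    rfl
  | pCase p hp =>
    obtain ⟨τ, h1, h2⟩ := fan p id rfl (fun _ => rfl) (fun i => by simp [Edge])
    have := τ.ofFn_comp_perm (fun i : Fin p => c i.castSucc.succ)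
    have e : (List.ofFn ((fun i : Fin p => c i.castSucc.succ) ∘ τ)) =
        List.ofFn (fun i : Fin p => c (σ i.castSucc.succ)) := by
      congr 1
      funext i
      exact congrArg c (h1 i).symm
    rw [e] at this
    have h2' : σ ⟨p + 1, by simp [order]⟩ = ⟨p + 1, by simp [order]⟩ := h2
    simp only [code, Function.comp_apply, h2']
    congr 2
    exact lexConcat_perm this
  | _ =>
    have h1 := hne ⟨1, by decide⟩ ⟨0, by decide⟩ (by simp)
    have h2 := hne ⟨2, by decide⟩ ⟨0, by decide⟩ (by simp)
    have h12 := hne ⟨1, by decide⟩ ⟨2, by decide⟩ (by simp)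
    have h3 := (σ ⟨1, by decide⟩).2
    have h4 := (σ ⟨2, by decide⟩).2
    have e1 := he ⟨1, by decide⟩ ⟨2, by decide⟩
    have e2 := he ⟨0, by decide⟩ ⟨1, by decide⟩
    have e3 := he ⟨1, by decide⟩ ⟨0, by decide⟩
    have h1 : σ ⟨1, by decide⟩ = ⟨1, by decide⟩ ∧ σ ⟨2, by decide⟩ = ⟨2, by decide⟩ := by
      suffices H : (σ ⟨1, by decide⟩).1 = 1 ∧ (σ ⟨2, by decide⟩).1 = 2 from
        ⟨Fin.ext H.1, Fin.ext H.2⟩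
      clear he hne fan hσ h0
      simp only [order, Edge, true_iff, true_and, false_and, and_true, and_false, true_or,
        false_or, or_true, or_false] at *
      omega
    simp only [code, Function.comp_apply, h1.1, h1.2]

theorem code_comp_of_eq {k k' : StatementKind} (hk : k = k') {σ : Fin k.order → Fin k'.order}
    (hσ : σ.Injective) (h0 : σ k.src = k'.src)
    (he : ∀ i j : Fin k.order, k.Edge i j ↔ k'.Edge (σ i) (σ j)) (c : Fin k'.order → List ℕ) :
    (k.code fun i => c (σ i)) = k'.code c := by
  subst hk
  exact k.code_comp hσ h0 he c

end StatementKind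

namespace RootedDigraph.Prime

variable {G : RootedDigraph.{u}}

/-- The out-neighbors of the common source lie in `Q` by closedness. If a further vertex of `P` were
outside `Q`, all of them would have an edge leaving `Q` and hence be the sink of `Q`. Then `Q` is a
sequence and `P` a repeat graph, whose edge back to the source contradicts that `Q` is induced. -/
theorem verts_subset_of_src_eq {P Q : G.Prime} (h : P.src = Q.src) : P.verts ⊆ Q.verts := by
  have hsrc : P.src ∈ Q.verts := h ▸ ⟨_, rfl⟩
  have hnb : ∀ i : Fin P.kind.order, P.kind.Edge 0 i → P.emb i ∈ Q.verts := fun i hi =>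
    Q.closed_out _ Q.kind.src_ne_snk _ (by
      change G.Adj Q.src _
      rw [← h]
      exact (P.adj_iff _ _).2 hi)
  rintro _ ⟨i, rfl⟩
  by_cases hi : i = P.kind.src
  · rw [hi]; exact hsrc
  rcases P.kind.edge_zero_or_forall (fun h => hi (Fin.ext h)) i.2 with he | he
  · exact hnb i he
  by_contra hni
  have key : ∀ (l : Fin P.kind.order) j, P.kind.Edge 0 l → Q.emb j = P.emb l → j = Q.kind.snk := by
    intro l j hl hj
    by_contra hne
    exact hni (Q.closed_out j hne _ (by rw [hj]; exact (P.adj_iff _ _).2 (he l hl).1))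
  have hP2 := (he 1 P.kind.edge_zero_one).2
  -- Vertex 1 of `Q` is an out-neighbor of the common source, so it lies in `P` and `key` applies to
  -- it; a sink with number 1 forces order 2.
  have hQ1 : (⟨1, Q.kind.two_le_order⟩ : Fin Q.kind.order) = Q.kind.snk := by
    obtain ⟨l, hl⟩ := P.closed_out _ P.kind.src_ne_snk (Q.emb ⟨1, Q.kind.two_le_order⟩) (by
      change G.Adj P.src _
      rw [h]
      exact (Q.adj_iff Q.kind.src ⟨1, Q.kind.two_le_order⟩).2 Q.kind.edge_zero_one)
    refine key l _ ?_ hl.symm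
    have := (Q.adj_iff Q.kind.src ⟨1, Q.kind.two_le_order⟩).2 Q.kind.edge_zero_one
    rw [← hl] at this
    exact (P.adj_iff P.kind.src l).1 (by change G.Adj P.src _; rw [h]; exact this)
  have hQ2 : Q.kind.order = 2 := by
    have := congrArg Fin.val hQ1
    simp only [StatementKind.snk] at this
    have := Q.kind.two_le_order
    omega
  have hone : P.emb ⟨1, P.kind.two_le_order⟩ = Q.emb Q.kind.snk := by
    obtain ⟨j, hj⟩ := hnb ⟨1, P.kind.two_le_order⟩ P.kind.edge_zero_one
    rw [← hj, key _ j P.kind.edge_zero_one hj]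
  have hP10 := StatementKind.edge_one_zero_of_unique (k := P.kind) (fun l hl => by
    obtain ⟨j, hj⟩ := hnb ⟨l, hl.lt_order.2⟩ hl
    rw [key ⟨l, hl.lt_order.2⟩ j hl hj, ← hone] at hj
    exact (congrArg Fin.val (P.emb_injective hj)).symm) hP2
  have := (P.adj_iff ⟨1, P.kind.two_le_order⟩ P.kind.src).2 hP10
  rw [hone] at this
  change G.Adj _ P.src at this
  rw [h, ← hQ1] at this
  exact StatementKind.not_edge_one_zero hQ2 ((Q.adj_iff _ _).1 this)

theorem verts_eq_of_src_eq {P Q : G.Prime} (h : P.src = Q.src) : P.verts = Q.verts :=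
  (verts_subset_of_src_eq h).antisymm (verts_subset_of_src_eq h.symm)

/-- The two embeddings have the same range and differ by a bijection that respects edges and source.
This forces equal kinds, and the code is invariant under automorphisms. -/
theorem code_eq_of_src_eq {P Q : G.Prime} (h : P.src = Q.src) (C : G.V → List ℕ) :
    P.code C = Q.code C := by
  have hv := verts_eq_of_src_eq h
  have hex : ∀ i, ∃ j, Q.emb j = P.emb i := fun i => by
    have : P.emb i ∈ Q.verts := hv ▸ ⟨i, rfl⟩
    exact this
  choose σ hσ using hex
  have hinj : σ.Injective := fun i j hij => P.emb_injective (by rw [← hσ, ← hσ, hij])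
  have hsurj : σ.Surjective := fun j => by
    have : Q.emb j ∈ P.verts := hv ▸ ⟨j, rfl⟩
    obtain ⟨i, hi⟩ := this
    exact ⟨i, Q.emb_injective ((hσ i).trans hi)⟩
  have h0 : σ P.kind.src = Q.kind.src := Q.emb_injective ((hσ _).trans h)
  have h0' : (σ ⟨0, P.kind.order_pos⟩).1 = 0 := congrArg Fin.val h0
  have he : ∀ i j : Fin P.kind.order, P.kind.Edge i j ↔ Q.kind.Edge (σ i) (σ j) := fun i j => by
    have h1 := P.adj_iff i j
    have h2 := Q.adj_iff (σ i) (σ j)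
    rw [hσ, hσ] at h2
    exact h1.symm.trans h2
  have ho : P.kind.order = Q.kind.order := by
    simpa using Fintype.card_of_bijective (f := σ) ⟨hinj, hsurj⟩
  have hk : P.kind = Q.kind := by
    refine StatementKind.eq_of_order_eq ho ⟨?_, ?_⟩ ⟨?_, ?_⟩
    · rintro ⟨j, hj⟩
      have := (he ⟨j, hj.lt_order.1⟩ ⟨0, P.kind.order_pos⟩).1 hj
      exact ⟨_, h0' ▸ this⟩
    · rintro ⟨j, hj⟩
      obtain ⟨i, hi⟩ := hsurj ⟨j, hj.lt_order.1⟩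
      refine ⟨i, (he i ⟨0, P.kind.order_pos⟩).2 ?_⟩
      rw [h0', hi]
      exact hj
    · intro H l l' hl hl'
      obtain ⟨i, hi⟩ := hsurj ⟨l, hl.lt_order.2⟩
      obtain ⟨i', hi'⟩ := hsurj ⟨l', hl'.lt_order.2⟩
      have := H i i' ((he ⟨0, P.kind.order_pos⟩ i).2 (by rw [h0', hi]; exact hl))
        ((he ⟨0, P.kind.order_pos⟩ i').2 (by rw [h0', hi']; exact hl'))
      have : i = i' := Fin.ext this
      subst this
      exact congrArg Fin.val (hi.symm.trans hi')
    · intro H l l' hl hl'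
      have h1 := (he ⟨0, P.kind.order_pos⟩ ⟨l, hl.lt_order.2⟩).1 hl
      have h2 := (he ⟨0, P.kind.order_pos⟩ ⟨l', hl'.lt_order.2⟩).1 hl'
      rw [h0'] at h1 h2
      exact congrArg Fin.val (hinj (Fin.ext (H _ _ h1 h2)))
  have hc : P.code C = P.kind.code fun i => C (Q.emb (σ i)) := by
    simp only [code, hσ]
  exact hc.trans (StatementKind.code_comp_of_eq hk hinj h0 he fun i => C (Q.emb i))

end RootedDigraph.Prime

/-! ### Programs and the lexicographic order of their positions -/

/-- A structured program: a tree whose leaves carry codes and whose inner nodes stand for statement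
graphs, the vertices of which are refined by the children. Children whose index is not a vertex of
the statement graph are irrelevant. -/
inductive Program where
  | leaf (c : List ℕ)
  | node (k : StatementKind) (f : ℕ → Program)

namespace Program

/-- The positions of the leaves, i.e. the vertices of the flow graph of a program. -/
def Pos : Program → List ℕ → Prop
  | leaf _, p => p = []
  | node _ _, [] => False
  | node k f, i :: p => i < k.order ∧ (f i).Pos p

/-- The source of the flow graph. -/
def root : Program → List ℕ
  | leaf _ => []
  | node _ f => 0 :: (f 0).root

/-- The sink of the flow graph. -/
def sink : Program → List ℕ
  | leaf _ => []
  | node k f => (k.order - 1) :: (f (k.order - 1)).sink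

/-- The edges of the flow graph. -/
def Edge : Program → List ℕ → List ℕ → Prop
  | leaf _, _, _ => False
  | node _ _, [], _ => False
  | node _ _, _ :: _, [] => False
  | node k f, i :: p, j :: q => (i = j ∧ i < k.order ∧ (f i).Edge p q) ∨
      (k.Edge i j ∧ p = (f i).sink ∧ q = (f j).root)

/-- The source of every statement graph is a vertex with the initial code. -/
def WF : Program → Prop
  | leaf _ => True
  | node k f => (∀ i, i = 0 ∨ k.order ≤ i → f i = leaf [1]) ∧ ∀ i, (f i).WF

/-- The code at a vertex. -/
def label : Program → List ℕ → List ℕ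
  | leaf c, _ => c
  | node _ _, [] => []
  | node _ f, i :: p => (f i).label p

/-- The vertex is not the source of a statement graph, i.e. it is expansible. -/
def IsX : Program → List ℕ → Prop
  | leaf _, _ => True
  | node _ _, [] => False
  | node _ f, i :: p => i ≠ 0 ∧ (f i).IsX p

/-- The code of a program. -/
def code : Program → List ℕ
  | leaf c => c
  | node k f => 1 :: k.code fun i => (f i).code

/-- The expansion of a leaf into a statement graph of kind `k` with vertex codes `cs`. -/
def expandAt (k : StatementKind) (cs : ℕ → List ℕ) : Program → List ℕ → Program
  | leaf _, _ => node k fun i => leaf (cs i)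
  | node k' f, [] => node k' f
  | node k' f, i :: p => node k' (Function.update f i ((f i).expandAt k cs p))

/-- The number of inner nodes. -/
def size : Program → ℕ
  | leaf _ => 0
  | node k f => 1 + ∑ i ∈ Finset.range k.order, (f i).size

theorem pos_root (T : Program) : T.Pos T.root := by
  induction T with
  | leaf c => rfl
  | node k f ih => exact ⟨k.order_pos, ih 0⟩

theorem pos_sink (T : Program) : T.Pos T.sink := by
  induction T with
  | leaf c => rfl
  | node k f ih => exact ⟨Nat.sub_lt k.order_pos one_pos, ih _⟩

theorem root_le (T : Program) : ∀ {p : List ℕ}, T.Pos p → T.root ≤ p := by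
  induction T with
  | leaf c => rintro p rfl; exact le_rfl
  | node k f ih =>
    rintro (_ | ⟨i, p⟩) h
    · exact h.elim
    · rcases Nat.eq_zero_or_pos i with rfl | hi
      · rcases (ih 0 h.2).eq_or_lt with he | hl
        · exact le_of_eq (congrArg _ he)
        · exact le_of_lt (List.cons_lt_cons_iff.2 (Or.inr ⟨rfl, hl⟩))
      · exact le_of_lt (List.cons_lt_cons_iff.2 (Or.inl hi))

theorem Edge.pos {T : Program} : ∀ {p q : List ℕ}, T.Edge p q → T.Pos p ∧ T.Pos q := by
  induction T with
  | leaf c => exact fun h => h.elim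
  | node k f ih =>
    rintro (_ | ⟨i, p⟩) (_ | ⟨j, q⟩) h
    · exact h.elim
    · exact h.elim
    · exact h.elim
    · rcases h with ⟨rfl, hi, h⟩ | ⟨h, rfl, rfl⟩
      · exact ⟨⟨hi, (ih i h).1⟩, hi, (ih i h).2⟩
      · exact ⟨⟨h.lt_order.1, pos_sink _⟩, h.lt_order.2, pos_root _⟩

theorem Edge.ne {T : Program} : ∀ {p q : List ℕ}, T.Edge p q → p ≠ q := by
  induction T with
  | leaf c => exact fun h => h.elim
  | node k f ih =>
    rintro (_ | ⟨i, p⟩) (_ | ⟨j, q⟩) h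
    · exact h.elim
    · exact h.elim
    · exact h.elim
    · rcases h with ⟨rfl, hi, h⟩ | ⟨h, rfl, rfl⟩
      · exact fun e => ih i h (List.cons.inj e).2
      · exact fun e => h.ne (List.cons.inj e).1

/-- An edge that goes down enters a vertex that is the only entry of a region with its tail. -/
theorem Edge.exists_entry {T : Program} : ∀ {p q : List ℕ}, T.Edge p q → q < p →
    ∃ D : Set (List ℕ), p ∈ D ∧ (T.root ∈ D → T.root = q) ∧
      ∀ x ∉ D, ∀ y ∈ D, T.Edge x y → y = q := by
  induction T with
  | leaf c => exact fun h => h.elim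
  | node k f ih =>
    rintro (_ | ⟨i, p⟩) (_ | ⟨j, q⟩) h hlt
    · exact h.elim
    · exact h.elim
    · exact h.elim
    · rcases h with ⟨rfl, hi, h⟩ | ⟨h, rfl, rfl⟩
      · have hlt' : q < p := by simpa using hlt
        obtain ⟨D, hp, hr, hD⟩ := ih i h hlt'
        -- The region found in the child still works: edges from other children enter child `i` only
        -- at its root, which equals the entry if it lies in the region.
        refine ⟨List.cons i '' D, ⟨p, hp, rfl⟩, ?_, ?_⟩
        · rintro ⟨r, hrD, he⟩
          obtain ⟨rfl, rfl⟩ := List.cons.inj he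
          exact congrArg _ (hr hrD)
        · rintro (_ | ⟨l, x⟩) hx _ ⟨y, hy, rfl⟩ hxy
          · exact hxy.elim
          · rcases hxy with ⟨rfl, -, hxy⟩ | ⟨-, -, rfl⟩
            · exact congrArg _ (hD x (fun hx' => hx ⟨x, hx', rfl⟩) y hy hxy)
            · exact congrArg _ (hr hy)
      · refine ⟨Set.univ, trivial, fun _ => ?_, fun x hx => (hx trivial).elim⟩
        rcases h.lt_or_eq_zero with h' | ⟨rfl, -⟩
        · exact absurd hlt (lt_asymm (List.cons_lt_cons_iff.2 (Or.inl h')))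
        · rfl

/-- The edges that are not cycle edges. -/
def Fwd (T : Program) (p q : List ℕ) : Prop := T.Edge p q ∧ p < q

theorem Fwd.cons {k : StatementKind} {f : ℕ → Program} {i : ℕ} (hi : i < k.order) {p q : List ℕ}
    (h : (f i).Fwd p q) : (node k f).Fwd (i :: p) (i :: q) :=
  ⟨Or.inl ⟨rfl, hi, h.1⟩, List.cons_lt_cons_iff.2 (Or.inr ⟨rfl, h.2⟩)⟩

theorem fwd_of_edge {k : StatementKind} {f : ℕ → Program} {i j : ℕ} (h : k.Edge i j)
    (hij : i < j) : (node k f).Fwd (i :: (f i).sink) (j :: (f j).root) :=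
  ⟨Or.inr ⟨h, rfl, rfl⟩, List.cons_lt_cons_iff.2 (Or.inl hij)⟩

theorem reach_root {T : Program} : ∀ {p : List ℕ}, T.Pos p →
    Relation.ReflTransGen T.Fwd T.root p := by
  induction T with
  | leaf c => rintro p rfl; exact .refl
  | node k f ih =>
    have inner : ∀ i < k.order, ∀ p, (f i).Pos p →
        Relation.ReflTransGen (node k f).Fwd (i :: (f i).root) (i :: p) := fun i hi p hp =>
      Relation.ReflTransGen.lift (List.cons i) (fun _ _ h => h.cons hi) _ _ (ih i hp)
    have outer : ∀ n, n < k.order →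
        Relation.ReflTransGen (node k f).Fwd (node k f).root (n :: (f n).root) := by
      intro n
      induction n using Nat.strong_induction_on with
      | _ n ihn =>
        intro hn
        by_cases h0 : n = 0
        · subst h0; exact .refl
        · obtain ⟨i, hi, he⟩ := k.exists_edge_lt h0 hn
          exact ((ihn i hi (hi.trans hn)).trans
            (inner i (hi.trans hn) _ (pos_sink _))).tail (fwd_of_edge he hi)
    rintro (_ | ⟨i, p⟩) h
    · exact h.elim
    · exact (outer i h.1).trans (inner i h.1 p h.2)

/-- Makes it possible to see that a forward path avoids a given vertex: it is enough that this
vertex is not smaller than the end of the path. -/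
theorem Fwd.reflTransGen_lt {T : Program} {p q : List ℕ} (h : Relation.ReflTransGen T.Fwd p q) :
    Relation.ReflTransGen (fun x y => T.Fwd x y ∧ x < q) p q := by
  induction h with
  | refl => exact .refl
  | tail _ h ih =>
    exact (Relation.ReflTransGen.mono (fun _ _ h' => ⟨h'.1, h'.2.trans h.2⟩) _ _ ih).tail ⟨h, h.2⟩

/-- The flow graph of a program. -/
def toGraph (T : Program) : RootedDigraph.{0} where
  V := {p : List ℕ // T.Pos p}
  graph := ⟨fun p q => T.Edge p.1 q.1⟩
  source := ⟨T.root, T.pos_root⟩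

theorem reach_toGraph {T : Program} {p q : List ℕ} (hp : T.Pos p) (hq : T.Pos q)
    (h : Relation.ReflTransGen T.Fwd p q) : Relation.ReflTransGen
      (fun x y : T.toGraph.V => T.toGraph.Adj x y ∧ x.1 < y.1) ⟨p, hp⟩ ⟨q, hq⟩ := by
  induction h with
  | refl => exact .refl
  | tail _ h ih => exact (ih h.1.pos.1).tail h

/-- From here on, cycle edges and descendants can be read off the order of the positions. -/
theorem isReducibleRank (T : Program) :
    T.toGraph.IsReducibleRank (fun p : {p : List ℕ // T.Pos p} => p.1) where
  ne p q h := h.ne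
  dom p q h hlt := by
    obtain ⟨D, hp, hr, hD⟩ := Edge.exists_entry h hlt
    exact ⟨Subtype.val ⁻¹' D, hp, fun h => Subtype.ext (hr h),
      fun x hx y hy hxy => Subtype.ext (hD x.1 hx y.1 hy hxy)⟩
  reach p := reach_toGraph _ p.2 (reach_root p.2)

theorem isDescendant_iff {T : Program} {p q : T.toGraph.V} :
    T.toGraph.IsDescendant p q ↔ Relation.ReflTransGen
      (fun x y : T.toGraph.V => T.toGraph.Adj x y ∧ x.1 < y.1) p q := by
  unfold RootedDigraph.IsDescendant
  simp only [T.isReducibleRank.not_isCycleEdge_iff]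

theorem le_of_isDescendant {T : Program} {p q : T.toGraph.V} (h : T.toGraph.IsDescendant p q) :
    p.1 ≤ q.1 := by
  rw [isDescendant_iff] at h
  induction h with
  | refl => exact le_rfl
  | tail _ h ih => exact ih.trans h.2.le

theorem isDescendant_of_reach {T : Program} {p q : T.toGraph.V}
    (h : Relation.ReflTransGen T.Fwd p.1 q.1) : T.toGraph.IsDescendant p q :=
  isDescendant_iff.2 (reach_toGraph p.2 q.2 h)

/-- A descending edge closes a loop at the source of a statement graph, and such a source is
regular. -/
theorem Edge.not_isX {T : Program} : ∀ {p q : List ℕ}, T.Edge p q → q < p → ¬ T.IsX q := by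
  induction T with
  | leaf c => exact fun h => h.elim
  | node k f ih =>
    rintro (_ | ⟨i, p⟩) (_ | ⟨j, q⟩) h hlt
    · exact h.elim
    · exact h.elim
    · exact h.elim
    · rcases h with ⟨rfl, hi, h⟩ | ⟨h, rfl, rfl⟩
      · exact fun hX => ih i h (by simpa using hlt) hX.2
      · rcases h.lt_or_eq_zero with h' | ⟨rfl, -⟩
        · exact absurd hlt (lt_asymm (List.cons_lt_cons_iff.2 (Or.inl h')))
        · exact fun hX => hX.1 rfl

/-- The source reaches the out-neighbors of an expansible vertex that does not end the body of a
loop by paths that avoid this vertex. -/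
theorem Edge.exists_detour {T : Program} : ∀ {v u : List ℕ}, T.WF → T.IsX v → T.Edge v u →
    (∀ w, T.Edge v w → v < w) →
    Relation.ReflTransGen (fun x y => T.Fwd x y ∧ x ≠ v) T.root u := by
  induction T with
  | leaf c => exact fun _ _ h => h.elim
  | node k f ih =>
    rintro (_ | ⟨i, p⟩) (_ | ⟨j, q⟩) hwf hX h hb
    · exact h.elim
    · exact h.elim
    · exact h.elim
    · rcases h with ⟨rfl, hi, h⟩ | ⟨h, rfl, rfl⟩
      · have h1 := ih i (hwf.2 i) hX.2 h fun w hw => by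
          simpa using hb (i :: w) (Or.inl ⟨rfl, hi, hw⟩)
        have h2 : Relation.ReflTransGen (fun x y => (node k f).Fwd x y ∧ x ≠ i :: p)
            (i :: (f i).root) (i :: q) :=
          Relation.ReflTransGen.lift (List.cons i)
            (fun _ _ h => ⟨h.1.cons hi, fun e => h.2 (List.cons.inj e).2⟩) _ _ h1
        -- The first portion of the path leads to the root of child `i`. It avoids the vertex in
        -- question, which is not smaller than this root.
        have h3 := Fwd.reflTransGen_lt
          (reach_root (T := node k f) (p := i :: (f i).root) ⟨hi, pos_root _⟩)
        refine (Relation.ReflTransGen.mono (fun x y h' => ⟨h'.1, ?_⟩) _ _ h3).trans h2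
        rintro rfl
        rcases (root_le (f i) h.pos.1).eq_or_lt with e | hl
        · rw [e] at h'
          exact lt_irrefl _ h'.2
        · exact lt_asymm h'.2 (List.cons_lt_cons_iff.2 (Or.inr ⟨rfl, hl⟩))
      · have hij : i < j := by
          have := hb (j :: (f j).root) (Or.inr ⟨h, rfl, rfl⟩)
          rcases List.cons_lt_cons_iff.1 this with h' | h'
          · exact h'
          · exact (h.ne h'.1).elim
        -- Child 0 is a single leaf, so the edges of the statement graph that leave its source start
        -- at the root of the program.
        have h0 : (node k f).root = 0 :: (f 0).sink := by
          simp only [root]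
          rw [hwf.1 0 (Or.inl rfl)]
          rfl
        have hne : ∀ l x, l ≠ i → l :: x ≠ i :: (f i).sink := fun l x hl e =>
          hl (List.cons.inj e).1
        rcases h.exists_detour hX.1 (fun h' => by
          have := hb (0 :: (f 0).root) (Or.inr ⟨h', rfl, rfl⟩)
          rcases List.cons_lt_cons_iff.1 this with h' | h'
          · exact absurd h' (by omega)
          · exact hX.1 h'.1) with he | ⟨l, hl, he, he'⟩
        · rw [h0]
          exact .single ⟨fwd_of_edge he (by omega), hne _ _ (Ne.symm hX.1)⟩
        · have hl0 : l ≠ 0 := fun e => he.ne e.symm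
          have hlj : l < j := by rcases he'.lt_or_eq_zero with h' | h' <;> omega
          rw [h0]
          refine .head ⟨fwd_of_edge he (by omega), hne _ _ (Ne.symm hX.1)⟩
            (.tail ?_ ⟨fwd_of_edge he' hlj, hne _ _ hl⟩)
          exact Relation.ReflTransGen.lift (List.cons l)
            (fun x y h => ⟨h.cons he.lt_order.2, hne _ _ hl⟩) _ _ (reach_root (pos_sink (f l)))

/-- No position is a prefix of another one; hence the positions `π ++ [i]` created by an expansion
are new. -/
theorem not_pos_append {T : Program} : ∀ {π : List ℕ} {i : ℕ}, T.Pos π → ¬ T.Pos (π ++ [i]) := by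
  induction T with
  | leaf c => rintro π i rfl h; simp [Pos] at h
  | node k f ih =>
    rintro (_ | ⟨j, π⟩) i h h'
    · exact h.elim
    · exact ih j h.2 h'.2

/-! ### Expansion of a leaf -/

section expandAt

variable {k : StatementKind} {cs : ℕ → List ℕ}

theorem root_expandAt {T : Program} : ∀ {π : List ℕ}, T.Pos π →
    (T.expandAt k cs π).root = if T.root = π then π ++ [0] else T.root := by
  induction T with
  | leaf c => rintro π rfl; rfl
  | node k' f ih =>
    rintro (_ | ⟨i, π⟩) h
    · exact h.elim
    · by_cases hi : i = 0
      · subst hi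
        simp only [expandAt, root, Function.update_self, ih 0 h.2, List.cons.injEq, true_and]
        split_ifs <;> simp
      · have hi' : ¬ (0 = i) := fun h => hi h.symm
        simp [expandAt, root, hi']

theorem sink_expandAt {T : Program} : ∀ {π : List ℕ}, T.Pos π →
    (T.expandAt k cs π).sink = if T.sink = π then π ++ [k.order - 1] else T.sink := by
  induction T with
  | leaf c => rintro π rfl; rfl
  | node k' f ih =>
    rintro (_ | ⟨i, π⟩) h
    · exact h.elim
    · by_cases hi : k'.order - 1 = i
      · subst hi
        simp only [expandAt, sink, Function.update_self, ih _ h.2, List.cons.injEq, true_and]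
        split_ifs <;> simp
      · simp [expandAt, sink, hi]

theorem pos_expandAt {T : Program} : ∀ {π x : List ℕ}, T.Pos π →
    ((T.expandAt k cs π).Pos x ↔ (T.Pos x ∧ x ≠ π) ∨ ∃ i < k.order, x = π ++ [i]) := by
  induction T with
  | leaf c =>
    rintro π x rfl
    rcases x with _ | ⟨j, x⟩
    · simp [expandAt, Pos]
    · simp [expandAt, Pos]
  | node k' f ih =>
    rintro (_ | ⟨i, π⟩) x h
    · exact h.elim
    · rcases x with _ | ⟨j, x⟩
      · simp [expandAt, Pos]
      · by_cases hi : j = i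
        · subst hi
          have := h.1
          simp [expandAt, Pos, ih _ h.2, this]
        · simp [expandAt, Pos, hi]

theorem edge_expandAt {T : Program} : ∀ {π x y : List ℕ}, T.Pos π →
    ((T.expandAt k cs π).Edge x y ↔ (T.Edge x y ∧ x ≠ π ∧ y ≠ π) ∨ (T.Edge x π ∧ y = π ++ [0]) ∨
      (T.Edge π y ∧ x = π ++ [k.order - 1]) ∨
      ∃ i j, x = π ++ [i] ∧ y = π ++ [j] ∧ k.Edge i j) := by
  induction T with
  | leaf c =>
    rintro π x y rfl
    rcases x with _ | ⟨a, x⟩ <;> rcases y with _ | ⟨b, y⟩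
    · simp [expandAt, Edge]
    · simp [expandAt, Edge]
    · simp [expandAt, Edge]
    · simp only [expandAt, Edge, root, sink, List.nil_append, List.cons.injEq, false_and, and_false,
        false_or]
      constructor
      · rintro ⟨h, rfl, rfl⟩
        exact ⟨a, b, ⟨rfl, rfl⟩, ⟨rfl, rfl⟩, h⟩
      · rintro ⟨i, j, ⟨rfl, rfl⟩, ⟨rfl, rfl⟩, h⟩
        exact ⟨h, rfl, rfl⟩
  | node k' f ih =>
    rintro (_ | ⟨i, π⟩) x y h
    · exact h.elim
    · have hno : ∀ j, ¬ k'.Edge j j := fun j h => h.ne rfl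
      have hpos := h.1
      rcases x with _ | ⟨a, x⟩
      · cases y <;> simp [expandAt, Edge]
      rcases y with _ | ⟨b, y⟩
      · simp [expandAt, Edge]
      by_cases ha : a = i
      · subst ha
        by_cases hb : b = a
        · subst hb
          simp [expandAt, Edge, ih _ h.2, hpos, hno]
        · have hb' : a ≠ b := fun h => hb h.symm
          simp only [expandAt, Edge, Function.update_self, Function.update_of_ne hb,
            sink_expandAt h.2, hb', hb, List.cons_append, List.cons.injEq, ne_eq, false_and,
            and_false, true_and, false_or, not_false_eq_true, and_true, or_false, exists_false]
          split_ifs with hs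
          · grind
          · grind
      · have ha' : i ≠ a := fun h => ha h.symm
        by_cases hb : b = i
        · subst hb
          simp only [expandAt, Edge, Function.update_self, Function.update_of_ne ha,
            root_expandAt h.2, ha, List.cons_append, List.cons.injEq, ne_eq, false_and,
            and_false, true_and, false_or, not_false_eq_true, or_false, exists_false]
          split_ifs with hs
          · grind
          · grind
        · simp [expandAt, Edge, ha, hb]

theorem label_expandAt {T : Program} : ∀ {π x : List ℕ}, T.Pos π → T.Pos x → x ≠ π →
    (T.expandAt k cs π).label x = T.label x := by
  induction T with
  | leaf c => rintro π x rfl rfl h; exact (h rfl).elim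
  | node k' f ih =>
    rintro (_ | ⟨i, π⟩) (_ | ⟨j, x⟩) h h' hne
    · exact h.elim
    · exact h.elim
    · exact h'.elim
    · by_cases hi : j = i
      · subst hi
        simp only [expandAt, label, Function.update_self]
        exact ih _ h.2 h'.2 (by simpa using hne)
      · simp only [expandAt, label, Function.update_of_ne hi]

theorem label_expandAt_append {T : Program} {i : ℕ} : ∀ {π : List ℕ}, T.Pos π →
    (T.expandAt k cs π).label (π ++ [i]) = cs i := by
  induction T with
  | leaf c => rintro π rfl; rfl
  | node k' f ih =>
    rintro (_ | ⟨j, π⟩) h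
    · exact h.elim
    · simp only [expandAt, label, List.cons_append, Function.update_self]
      exact ih _ h.2

theorem isX_expandAt {T : Program} : ∀ {π x : List ℕ}, T.Pos π → T.Pos x → x ≠ π →
    ((T.expandAt k cs π).IsX x ↔ T.IsX x) := by
  induction T with
  | leaf c => rintro π x rfl rfl h; exact (h rfl).elim
  | node k' f ih =>
    rintro (_ | ⟨i, π⟩) (_ | ⟨j, x⟩) h h' hne
    · exact h.elim
    · exact h.elim
    · exact h'.elim
    · by_cases hi : j = i
      · subst hi
        simp only [expandAt, IsX, Function.update_self]
        rw [ih _ h.2 h'.2 (by simpa using hne)]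
      · simp only [expandAt, IsX, Function.update_of_ne hi]

theorem isX_expandAt_append {T : Program} {i : ℕ} : ∀ {π : List ℕ}, T.Pos π → T.IsX π →
    ((T.expandAt k cs π).IsX (π ++ [i]) ↔ i ≠ 0) := by
  induction T with
  | leaf c => rintro π rfl _; simp [expandAt, IsX]
  | node k' f ih =>
    rintro (_ | ⟨j, π⟩) h hX
    · exact h.elim
    · simp only [expandAt, IsX, List.cons_append, Function.update_self]
      rw [ih _ h.2 hX.2]
      simp [hX.1]

theorem wf_expandAt {T : Program} (hcs : ∀ i, i = 0 ∨ k.order ≤ i → cs i = [1]) :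
    ∀ {π : List ℕ}, T.Pos π → T.IsX π → T.WF → (T.expandAt k cs π).WF := by
  induction T with
  | leaf c =>
    rintro π rfl _ _
    exact ⟨fun i hi => congrArg leaf (hcs i hi), fun _ => trivial⟩
  | node k' f ih =>
    rintro (_ | ⟨j, π⟩) h hX hwf
    · exact h.elim
    · refine ⟨fun i hi => ?_, fun i => ?_⟩
      · have hij : i ≠ j := by have := h.1; have := hX.1; omega
        rw [Function.update_of_ne hij]
        exact hwf.1 i hi
      · by_cases hij : i = j
        · subst hij
          rw [Function.update_self]
          exact ih _ h.2 hX.2 (hwf.2 _)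
        · rw [Function.update_of_ne hij]
          exact hwf.2 i

/-- The invariant of contraction: a leaf whose label is the code accumulated by an innermost node
contributes to the total code what that node did. -/
theorem code_expandAt {T : Program} : ∀ {π : List ℕ}, T.Pos π →
    T.label π = 1 :: k.code (fun i => cs i) → (T.expandAt k cs π).code = T.code := by
  induction T with
  | leaf c => rintro π rfl h; exact h.symm
  | node k' f ih =>
    rintro (_ | ⟨j, π⟩) h hl
    · exact h.elim
    · simp only [expandAt, code]
      congr 2
      funext i
      by_cases hij : i.1 = j
      · rw [hij, Function.update_self]
        exact ih _ h.2 hl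
      · rw [Function.update_of_ne hij]

theorem size_expandAt {T : Program} : ∀ {π : List ℕ}, T.Pos π →
    (T.expandAt k cs π).size = T.size + 1 := by
  induction T with
  | leaf c => rintro π rfl; simp [expandAt, size]
  | node k' f ih =>
    rintro (_ | ⟨j, π⟩) h
    · exact h.elim
    · have hj : j ∈ Finset.range k'.order := Finset.mem_range.2 h.1
      simp only [expandAt, size]
      rw [← Finset.add_sum_erase _ _ hj, ← Finset.add_sum_erase _ (fun i => (f i).size) hj,
        Function.update_self, ih _ h.2]
      rw [Finset.sum_congr rfl fun i hi => by
        rw [Function.update_of_ne (Finset.ne_of_mem_erase hi)]]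
      ring

end expandAt

/-- The flow graph of `T.expandAt k cs π` is the expansion of the flow graph of `T`. -/
theorem exists_iso_expand (T : Program) (k : StatementKind) (cs : ℕ → List ℕ) {π : List ℕ}
    (hπ : T.Pos π) : ∃ e : (T.toGraph.expand ⟨π, hπ⟩ k).Iso (T.expandAt k cs π).toGraph,
      (∀ w, (e.toEquiv (Sum.inl w)).1 = w.1.1) ∧ ∀ i, (e.toEquiv (Sum.inr i)).1 = π ++ [i.1] := by
  let F : {w : T.toGraph.V // w ≠ ⟨π, hπ⟩} ⊕ Fin k.order → (T.expandAt k cs π).toGraph.V :=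
    Sum.elim (fun w => ⟨w.1.1, (pos_expandAt hπ).2 (Or.inl ⟨w.1.2, fun h => w.2 (Subtype.ext h)⟩)⟩)
      (fun i => ⟨π ++ [i.1], (pos_expandAt hπ).2 (Or.inr ⟨i.1, i.2, rfl⟩)⟩)
  have hne : ∀ (w : T.toGraph.V) (i : ℕ), w.1 ≠ π ++ [i] := fun w i h =>
    not_pos_append hπ (h ▸ w.2)
  have hF : F.Bijective := by
    constructor
    · rintro (w | i) (z | j) h
      · have h' : w.1.1 = z.1.1 := congrArg (fun t => t.1) h
        exact congrArg Sum.inl (Subtype.ext (Subtype.ext h'))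
      · exact (hne w.1 j (congrArg Subtype.val h)).elim
      · exact (hne z.1 i (congrArg Subtype.val h).symm).elim
      · have h' : π ++ [i.1] = π ++ [j.1] := congrArg (fun t => t.1) h
        simp only [List.append_cancel_left_eq, List.cons.injEq, and_true] at h'
        exact congrArg Sum.inr (Fin.ext h')
    · rintro ⟨x, hx⟩
      rcases (pos_expandAt hπ).1 hx with ⟨h, hn⟩ | ⟨i, hi, rfl⟩
      · exact ⟨Sum.inl ⟨⟨x, h⟩, fun e => hn (congrArg Subtype.val e)⟩, rfl⟩
      · exact ⟨Sum.inr ⟨i, hi⟩, rfl⟩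
  have hπa : ∀ i : ℕ, π ≠ π ++ [i] := fun i h => by simp at h
  have hE1 : ∀ x i, ¬ T.Edge x (π ++ [i]) := fun x i h => not_pos_append hπ h.pos.2
  have hE2 : ∀ x i, ¬ T.Edge (π ++ [i]) x := fun x i h => not_pos_append hπ h.pos.1
  refine ⟨⟨Equiv.ofBijective F hF, ?_, ?_⟩, fun w => rfl, fun i => rfl⟩
  · rintro (w | i) (z | j)
    · have hw : w.1.1 ≠ π := fun h => w.2 (Subtype.ext h)
      have hz : z.1.1 ≠ π := fun h => z.2 (Subtype.ext h)
      change T.Edge w.1.1 z.1.1 ↔ (T.expandAt k cs π).Edge w.1.1 z.1.1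
      simp [edge_expandAt hπ, hw, hz, hne]
    · have hw : w.1.1 ≠ π := fun h => w.2 (Subtype.ext h)
      change T.Edge w.1.1 π ∧ j = k.src ↔ (T.expandAt k cs π).Edge w.1.1 (π ++ [j.1])
      simp [edge_expandAt hπ, hw, hne, hE1, Fin.ext_iff, StatementKind.src]
    · have hz : z.1.1 ≠ π := fun h => z.2 (Subtype.ext h)
      change T.Edge π z.1.1 ∧ i = k.snk ↔ (T.expandAt k cs π).Edge (π ++ [i.1]) z.1.1
      simp [edge_expandAt hπ, hz, hne, hE2, Fin.ext_iff, StatementKind.snk]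
    · change k.Edge i.1 j.1 ↔ (T.expandAt k cs π).Edge (π ++ [i.1]) (π ++ [j.1])
      simp [edge_expandAt hπ, hE1, hE2]
  · refine Subtype.ext ?_
    change (F _).1 = (T.expandAt k cs π).root
    rw [root_expandAt hπ]
    unfold RootedDigraph.expand
    by_cases h : T.root = π
    · have h' : T.toGraph.source = ⟨π, hπ⟩ := Subtype.ext h
      simp only [dif_pos h', if_pos h]
      rfl
    · have h' : T.toGraph.source ≠ ⟨π, hπ⟩ := fun e => h (congrArg Subtype.val e)
      simp only [dif_neg h', if_neg h]
      rfl

theorem lt_append_singleton (π : List ℕ) (a : ℕ) : π < π ++ [a] := by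
  induction π with
  | nil => exact List.nil_lt_cons _ _
  | cons b π ih => exact List.cons_lt_cons_iff.2 (Or.inr ⟨rfl, ih⟩)

/-- The statement graph inserted by an expansion is prime. -/
def primeAt (T : Program) (k : StatementKind) (cs : ℕ → List ℕ) {π : List ℕ}
    (hπ : T.Pos π) (hX : T.IsX π) : (T.expandAt k cs π).toGraph.Prime where
  kind := k
  emb i := ⟨π ++ [i.1], (pos_expandAt hπ).2 (Or.inr ⟨i.1, i.2, rfl⟩)⟩
  emb_injective i j h := by simpa [Fin.ext_iff] using congrArg Subtype.val h
  adj_iff i j := by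
    have hE : ∀ x i, ¬ T.Edge x (π ++ [i]) := fun x i h => not_pos_append hπ h.pos.2
    have hE' : ∀ x i, ¬ T.Edge (π ++ [i]) x := fun x i h => not_pos_append hπ h.pos.1
    change (T.expandAt k cs π).Edge (π ++ [i.1]) (π ++ [j.1]) ↔ k.Edge i j
    simp [edge_expandAt hπ, hE, hE']
  cycleEdge_iff i j := by
    have hE : ∀ x i, ¬ T.Edge x (π ++ [i]) := fun x i h => not_pos_append hπ h.pos.2
    have hE' : ∀ x i, ¬ T.Edge (π ++ [i]) x := fun x i h => not_pos_append hπ h.pos.1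
    refine (isReducibleRank _).isCycleEdge_iff.trans
      (Iff.trans ?_ k.isReducibleRank.isCycleEdge_iff.symm)
    change (T.expandAt k cs π).Edge (π ++ [i.1]) (π ++ [j.1]) ∧ (π ++ [j.1] < π ++ [i.1]) ↔
      k.Edge i j ∧ j.1 < i.1
    have : π ++ [j.1] < π ++ [i.1] ↔ j.1 < i.1 := by
      clear hE hE' hπ hX
      induction π with
      | nil => simp [List.cons_lt_cons_iff]
      | cons a π ih => simpa [List.cons_lt_cons_iff] using ih
    rw [this]
    simp [edge_expandAt hπ, hE, hE']
  closed_in i hi w hw := by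
    rcases (edge_expandAt hπ).1 hw with h | ⟨-, h⟩ | ⟨h, -⟩ | ⟨a, b, ha, -, h⟩
    · exact (not_pos_append hπ h.1.pos.2).elim
    · simp only [List.append_cancel_left_eq, List.cons.injEq, and_true] at h
      exact (hi (Fin.ext h)).elim
    · exact (not_pos_append hπ h.pos.2).elim
    · exact ⟨⟨a, h.lt_order.1⟩, Subtype.ext ha.symm⟩
  closed_out i hi w hw := by
    rcases (edge_expandAt hπ).1 hw with h | ⟨h, -⟩ | ⟨-, h⟩ | ⟨a, b, -, hb, h⟩
    · exact (not_pos_append hπ h.1.pos.1).elim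
    · exact (not_pos_append hπ h.pos.1).elim
    · simp only [List.append_cancel_left_eq, List.cons.injEq, and_true] at h
      exact (hi (Fin.ext h)).elim
    · exact ⟨⟨b, h.lt_order.2⟩, Subtype.ext hb.symm⟩
  closed_cycle w hw := by
    obtain ⟨hw, hlt⟩ := (isReducibleRank _).isCycleEdge_iff.1 hw
    change (T.expandAt k cs π).Edge w.1 (π ++ [0]) at hw
    change (T.expandAt k cs π).Edge (π ++ [0]) w.1
    change π ++ [0] < w.1 at hlt
    -- A cycle edge from outside would be a descending edge of `T` into the expansible vertex `π`. A
    -- cycle edge from inside is the back edge of a loop, and the source of a loop graph also has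
    -- the edge in the opposite direction.
    rcases (edge_expandAt hπ).1 hw with h | ⟨h, -⟩ | ⟨h, -⟩ | ⟨a, b, ha, hb, h⟩
    · exact (not_pos_append hπ h.1.pos.2).elim
    · exact (h.not_isX ((lt_append_singleton π 0).trans hlt) hX).elim
    · exact (not_pos_append hπ h.pos.2).elim
    · simp only [List.append_cancel_left_eq, List.cons.injEq, and_true] at hb
      subst hb
      rw [ha]
      refine (edge_expandAt hπ).2 (Or.inr (Or.inr (Or.inr ⟨_, _, rfl, rfl, ?_⟩)))
      exact (h.lt_or_eq_zero.resolve_left (by omega)).2.2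

/-! ### Innermost statement graphs and lowest prime subgraphs -/

/-- `T` arises from `T₀` by expanding the leaf `π`, the code of which agrees with the codes of the
vertices of the statement graph. -/
structure IsExpansion (T T₀ : Program) (π : List ℕ) (k : StatementKind) (cs : ℕ → List ℕ) :
    Prop where
  wf : T₀.WF
  pos : T₀.Pos π
  isX : T₀.IsX π
  eq : T = T₀.expandAt k cs π
  zero : cs 0 = [1]
  label : T₀.label π = 1 :: k.code fun i => cs i

theorem IsExpansion.cons {k' : StatementKind} {f : ℕ → Program} {T₀ : Program} {π : List ℕ}
    {k : StatementKind} {cs : ℕ → List ℕ} {i : ℕ} (hi : i ≠ 0) (hi' : i < k'.order)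
    (hf : (node k' f).WF) (h : (f i).IsExpansion T₀ π k cs) :
    (node k' f).IsExpansion (node k' (Function.update f i T₀)) (i :: π) k cs where
  wf := by
    refine ⟨fun j hj => ?_, fun j => ?_⟩
    · rw [Function.update_of_ne (by omega)]
      exact hf.1 j hj
    · by_cases hij : j = i
      · subst hij
        rw [Function.update_self]
        exact h.wf
      · rw [Function.update_of_ne hij]
        exact hf.2 j
  pos := ⟨hi', by rw [Function.update_self]; exact h.pos⟩
  isX := ⟨hi, by rw [Function.update_self]; exact h.isX⟩
  eq := by
    simp only [expandAt, Function.update_self, Function.update_idem, ← h.eq]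
    rw [Function.update_eq_self]
  zero := h.zero
  label := by
    simp only [Program.label, Function.update_self]
    exact h.label

/-- Descending into children that are not leaves ends at a node with leaves only; collapsing it to a
leaf with the accumulated code gives `T₀`. -/
theorem exists_isExpansion {T : Program} : T.WF → (∀ c, T ≠ leaf c) →
    ∃ T₀ π k cs, T.IsExpansion T₀ π k cs := by
  induction T with
  | leaf c => exact fun _ h => (h c rfl).elim
  | node k f ih =>
    intro hwf _
    by_cases hl : ∃ i, ∀ c, f i ≠ leaf c
    · obtain ⟨i, hi⟩ := hl
      obtain ⟨T₀, π, k', cs, h⟩ := ih i (hwf.2 i) hi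
      have hi' : ¬ (i = 0 ∨ k.order ≤ i) := fun h => hi _ (hwf.1 i h)
      exact ⟨_, _, _, _, h.cons (by omega) (by omega) hwf⟩
    · push Not at hl
      choose cs hcs using hl
      refine ⟨leaf (1 :: k.code fun i => cs i), [], k, cs, trivial, rfl, trivial, ?_, ?_, rfl⟩
      · simp only [expandAt]
        exact congrArg _ (funext hcs)
      · have := hwf.1 0 (Or.inl rfl)
        rw [hcs] at this
        exact (leaf.injEq _ _).mp this

theorem IsExpansion.pos_append {T T₀ : Program} {π : List ℕ} {k : StatementKind}
    {cs : ℕ → List ℕ} (h : T.IsExpansion T₀ π k cs) : T.Pos (π ++ [0]) := by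
  rw [h.eq]
  exact (pos_expandAt h.pos).2 (Or.inr ⟨0, k.order_pos, rfl⟩)

/-- A regular vertex is the root of some subtree that is not a leaf. Any innermost node of this
subtree serves, because a root reaches all positions of its tree by forward edges. -/
theorem exists_isExpansion_below {T : Program} : ∀ {v : List ℕ}, T.WF → T.Pos v → ¬ T.IsX v →
    ∃ T₀ π k cs, T.IsExpansion T₀ π k cs ∧ Relation.ReflTransGen T.Fwd v (π ++ [0]) := by
  induction T with
  | leaf c => exact fun _ _ h => (h trivial).elim
  | node k f ih =>
    rintro (_ | ⟨i, p⟩) hwf hv hX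
    · exact hv.elim
    · by_cases hi : i = 0
      · subst hi
        obtain ⟨T₀, π, k', cs, h⟩ := exists_isExpansion hwf (fun c => by simp)
        refine ⟨T₀, π, k', cs, h, ?_⟩
        have hv' : (node k f).root = 0 :: p := by
          have := hv.2
          rw [hwf.1 0 (Or.inl rfl)] at this
          rw [root, hwf.1 0 (Or.inl rfl), show p = [] from this]
          rfl
        rw [← hv']
        exact reach_root h.pos_append
      · obtain ⟨T₀, π, k', cs, h, hr⟩ := ih i (hwf.2 i) hv.2 fun h => hX ⟨hi, h⟩
        exact ⟨_, _, _, _, h.cons hi hv.1 hwf,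
          Relation.ReflTransGen.lift (List.cons i) (fun _ _ h => h.cons hv.1) _ _ hr⟩

variable {T : Program}

/-- This is where the correspondence of cycle edges in a prime subgraph matters: an ascending edge
of the statement graph is no cycle edge, so its image ascends too. -/
theorem prime_lt_of_edge (P : T.toGraph.Prime) {i j : Fin P.kind.order} (h : P.kind.Edge i j)
    (hij : i < j) : (P.emb i).1 < (P.emb j).1 := by
  have h1 : T.toGraph.Adj (P.emb i) (P.emb j) := (P.adj_iff i j).2 h
  have h2 : ¬ T.toGraph.IsCycleEdge (P.emb i) (P.emb j) := fun hc =>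
    lt_asymm hij (P.kind.isReducibleRank.isCycleEdge_iff.1 ((P.cycleEdge_iff i j).1 hc)).2
  exact (T.isReducibleRank.not_isCycleEdge_iff.1 ⟨h1, h2⟩).2

theorem prime_src_le (P : T.toGraph.Prime) {x : T.toGraph.V} (hx : x ∈ P.verts) :
    P.src.1 ≤ x.1 := by
  suffices H : ∀ n (hn : n < P.kind.order), P.src.1 ≤ (P.emb ⟨n, hn⟩).1 by
    obtain ⟨i, rfl⟩ := hx
    exact H i.1 i.2
  intro n
  induction n using Nat.strong_induction_on with
  | _ n ih =>
    intro hn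
    by_cases h0 : n = 0
    · subst h0; exact le_rfl
    · obtain ⟨i, hi, he⟩ := P.kind.exists_edge_lt h0 hn
      exact (ih i hi (hi.trans hn)).trans
        (prime_lt_of_edge P (i := ⟨i, hi.trans hn⟩) (j := ⟨n, hn⟩) he hi).le

/-- An expansible vertex is not the source of a prime subgraph. -/
theorem not_isX_prime_src (hwf : T.WF) (P : T.toGraph.Prime) : ¬ T.IsX P.src.1 := by
  intro hX
  have hlt1 := prime_lt_of_edge P (i := P.kind.src) (j := ⟨1, P.kind.two_le_order⟩)
    P.kind.edge_zero_one (Nat.one_pos : 0 < 1)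
  have hE1 : T.toGraph.Adj P.src (P.emb ⟨1, P.kind.two_le_order⟩) :=
    (P.adj_iff P.kind.src ⟨1, P.kind.two_le_order⟩).2 P.kind.edge_zero_one
  have hb : ∀ w, T.Edge P.src.1 w → P.src.1 < w := by
    intro w hw
    obtain ⟨j, hj⟩ := P.closed_out _ P.kind.src_ne_snk ⟨w, hw.pos.2⟩ hw
    have he : P.kind.Edge 0 j := (P.adj_iff P.kind.src j).1 (by rw [hj]; exact hw)
    have := prime_lt_of_edge P (i := P.kind.src) (j := j) he
      (Nat.pos_of_ne_zero fun h => he.ne h.symm)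
    rw [hj] at this
    exact this
  have hpath := Edge.exists_detour hwf hX hE1 hb
  -- The detour is followed backwards from vertex 1. It avoids the source of `P`, so closedness
  -- never lets it leave `P`. Thus the root of `T` would be a vertex of `P` other than its source,
  -- although it is the smallest position and the source the smallest vertex of `P`.
  have key : ∀ x, Relation.ReflTransGen (fun x y => T.Fwd x y ∧ x ≠ P.src.1) x
      (P.emb ⟨1, P.kind.two_le_order⟩).1 →
      ∃ h : T.Pos x, (⟨x, h⟩ : T.toGraph.V) ∈ P.verts ∧ x ≠ P.src.1 := by
    intro x hx
    induction hx using Relation.ReflTransGen.head_induction_on with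
    | refl => exact ⟨(P.emb _).2, ⟨_, rfl⟩, hlt1.ne'⟩
    | head h _ ih =>
      obtain ⟨hy, ⟨j, hj⟩, hne⟩ := ih
      refine ⟨h.1.1.pos.1, ?_, h.2⟩
      refine P.closed_in j ?_ _ (by rw [hj]; exact h.1.1)
      rintro rfl
      exact hne (congrArg Subtype.val hj).symm
  obtain ⟨h, hm, hne⟩ := key _ hpath
  exact hne ((root_le T P.src.2).antisymm (prime_src_le P hm))

/-- The source of `P` is regular, so an innermost statement graph has its source among the
descendants. As `P` is lowest, both have the same vertices, and each source is the least of them. -/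
theorem exists_isExpansion_of_isLowest (hwf : T.WF) {P : T.toGraph.Prime} (hP : P.IsLowest) :
    ∃ T₀ π k cs, T.IsExpansion T₀ π k cs ∧ P.src.1 = π ++ [0] := by
  obtain ⟨T₀, π, k, cs, h, hr⟩ := exists_isExpansion_below hwf P.src.2 (not_isX_prime_src hwf P)
  refine ⟨T₀, π, k, cs, h, ?_⟩
  obtain ⟨hwf₀, hπ, hX, rfl, -, -⟩ := h
  let Q := T₀.primeAt k cs hπ hX
  have hv : Q.verts = P.verts := by
    by_contra hne
    exact hP Q hne (isDescendant_of_reach hr)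
  exact le_antisymm (prime_src_le P (x := Q.src) (hv ▸ ⟨_, rfl⟩))
    (prime_src_le Q (x := P.src) (hv ▸ ⟨_, rfl⟩))

/-- Contraction inverts the expansion, and the updated code of the source is the label of the leaf
`π` of `T₀`. Only the source of `P` has to be known, since it determines vertices and code. -/
theorem codeFrom_contract_iff {T₀ : Program} {π : List ℕ} {k : StatementKind} {cs : ℕ → List ℕ}
    (h : T.IsExpansion T₀ π k cs) {P : T.toGraph.Prime} (hP : P.src.1 = π ++ [0]) (c : List ℕ) :
    P.contract.CodeFrom (P.updateCode fun p => T.label p.1) c ↔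
      T₀.toGraph.CodeFrom (fun p => T₀.label p.1) c := by
  obtain ⟨hwf₀, hπ, hX, rfl, hcs, hl⟩ := h
  obtain ⟨e, he1, he2⟩ := exists_iso_expand T₀ k cs hπ
  have hsrc : P.src = (T₀.primeAt k cs hπ hX).src := Subtype.ext hP
  have hv : ∀ x, x ∈ P.verts ↔ ∃ i : Fin k.order, e.symm.toEquiv x = Sum.inr i := by
    intro x
    rw [RootedDigraph.Prime.verts_eq_of_src_eq hsrc]
    refine exists_congr fun i => ?_
    refine Iff.trans ?_ (Equiv.symm_apply_eq e.toEquiv).symm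
    constructor
    · rintro rfl
      exact Subtype.ext (he2 i).symm
    · rintro rfl
      exact Subtype.ext (he2 i).symm
  obtain ⟨f, hf⟩ := RootedDigraph.Prime.exists_iso_of_expand
    (fun a ha => Edge.ne ha rfl) e.symm P hv
  have key : ∀ a : P.ContractVert,
      P.updateCode (fun p => (T₀.expandAt k cs π).label p.1) a = T₀.label (f.toEquiv a).1 := by
    intro a
    rw [hf]
    by_cases ha : a.1 = P.src
    · have h1 : e.symm.toEquiv a.1 = Sum.inr k.src := by
        refine (Equiv.symm_apply_eq e.toEquiv).2 ?_
        rw [ha, hsrc]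
        exact Subtype.ext (he2 _).symm
      rw [h1]
      unfold RootedDigraph.Prime.updateCode
      rw [if_pos ha, RootedDigraph.Prime.code_eq_of_src_eq hsrc]
      change (T₀.expandAt k cs π).label P.src.1 ++
        (k.code fun i => (T₀.expandAt k cs π).label (π ++ [i.1])) = T₀.label π
      simp only [hP, label_expandAt_append hπ, hcs, hl, List.singleton_append]
    · have ha' : a.1 ∉ P.verts := a.2.resolve_right ha
      rcases h1 : e.symm.toEquiv a.1 with w | i
      · unfold RootedDigraph.Prime.updateCode
        rw [if_neg ha]
        have h2 : a.1.1 = w.1.1 :=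
          (congrArg Subtype.val ((Equiv.symm_apply_eq _).1 h1)).trans (he1 w)
        change (T₀.expandAt k cs π).label a.1.1 = T₀.label w.1.1
        rw [h2]
        exact label_expandAt hπ w.1.2 fun h => w.2 (Subtype.ext h)
      · exact (ha' ((hv _).2 ⟨i, h1⟩)).elim
  have hC : (P.updateCode fun p => (T₀.expandAt k cs π).label p.1) ∘ f.toEquiv.symm =
      fun p => T₀.label p.1 := by
    rw [Equiv.comp_symm_eq]
    exact funext key
  have hC' : (fun p => T₀.label p.1) ∘ f.symm.toEquiv.symm =
      (P.updateCode fun p => (T₀.expandAt k cs π).label p.1) := funext fun a => (key a).symm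
  constructor
  · intro h
    rw [← hC]
    exact RootedDigraph.Iso.codeFrom h _ f
  · intro h
    rw [← hC']
    exact RootedDigraph.Iso.codeFrom h _ f.symm

theorem finite_pos (T : Program) : {p | T.Pos p}.Finite := by
  induction T with
  | leaf c => exact Set.finite_singleton _
  | node k f ih =>
    refine ((Set.finite_lt_nat k.order).biUnion fun i _ => (ih i).image (List.cons i)).subset ?_
    rintro (_ | ⟨i, p⟩) h
    · exact h.elim
    · exact Set.mem_biUnion h.1 ⟨p, h.2, rfl⟩

/-- Descendants are never smaller, so a prime subgraph with the largest source is lowest. -/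
theorem exists_isLowest (P₀ : T.toGraph.Prime) : ∃ P : T.toGraph.Prime, P.IsLowest := by
  have hfin : (Set.range fun P : T.toGraph.Prime => P.src.1).Finite :=
    T.finite_pos.subset (by rintro _ ⟨P, rfl⟩; exact P.src.2)
  obtain ⟨_, ⟨P, rfl⟩, hmax⟩ := Set.exists_max_image _ id hfin ⟨_, P₀, rfl⟩
  refine ⟨P, fun Q hQ hd => hQ (RootedDigraph.Prime.verts_eq_of_src_eq (Subtype.ext ?_))⟩
  exact le_antisymm (hmax _ ⟨Q, rfl⟩) (le_of_isDescendant hd)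

/-- Every maximal bottom-up contractile sequence of the flow graph of a program computes the code
of the program. -/
theorem codeFrom_iff : ∀ (n : ℕ) (T : Program), T.size = n → T.WF → ∀ c,
    T.toGraph.CodeFrom (fun p => T.label p.1) c ↔ c = T.code := by
  intro n
  induction n with
  | zero =>
    rintro (c₀ | ⟨k, f⟩) hT hwf c
    · have hempty : IsEmpty (leaf c₀).toGraph.Prime := ⟨fun P =>
        (P.adj_iff P.kind.src ⟨1, P.kind.two_le_order⟩).2 P.kind.edge_zero_one⟩
      constructor
      · intro h
        cases h with
        | done => rfl
        | step _ _ H => exact hempty.elim H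
      · rintro rfl
        exact .done _ _ hempty
    · simp [size] at hT
  | succ n ih =>
    intro T hT hwf c
    have hne : ∀ c, T ≠ leaf c := by rintro c rfl; simp [size] at hT
    -- Whichever lowest prime subgraph is chosen, its contraction is the flow graph of a program
    -- with one node fewer and the same code.
    have hstep : ∀ P : T.toGraph.Prime, P.IsLowest →
        (P.contract.CodeFrom (P.updateCode fun p => T.label p.1) c ↔ c = T.code) := by
      intro P hP
      obtain ⟨T₀, π, k, cs, h, hsrc⟩ := exists_isExpansion_of_isLowest hwf hP
      have hsize : T₀.size = n := by
        have := size_expandAt (k := k) (cs := cs) h.pos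
        rw [← h.eq, hT] at this
        omega
      rw [codeFrom_contract_iff h hsrc, ih T₀ hsize h.wf, ← code_expandAt h.pos h.label, ← h.eq]
    obtain ⟨P₀⟩ : Nonempty T.toGraph.Prime := by
      obtain ⟨T₀, π, k, cs, h⟩ := exists_isExpansion hwf hne
      rw [h.eq]
      exact ⟨T₀.primeAt k cs h.pos h.isX⟩
    constructor
    · intro h
      cases h with
      | done _ _ hE => exact hE.elim P₀
      | step _ _ H hH _ h => exact (hstep H hH).1 h
    · intro h
      obtain ⟨P, hP⟩ := exists_isLowest P₀
      exact .step _ _ P hP c ((hstep P hP).2 h)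

end Program

/-! ### Unique parsing of codes -/

/-- The strings that may follow a code. -/
def IsTail (r : List ℕ) : Prop := r = [] ∨ ∃ t, r = 1 :: t

theorem IsTail.append {c r : List ℕ} (hc : ∃ t, c = 1 :: t) : IsTail (c ++ r) := by
  obtain ⟨t, rfl⟩ := hc
  exact Or.inr ⟨t ++ r, rfl⟩

theorem IsTail.flatten_append {r : List ℕ} (hr : IsTail r) :
    ∀ {L : List (List ℕ)}, (∀ a ∈ L, ∃ t, a = 1 :: t) → IsTail (L.flatten ++ r)
  | [], _ => hr
  | a :: L, h => by
    rw [List.flatten_cons, List.append_assoc]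
    exact .append (h a (by simp))

/-- If one of two strings is a prefix of the other up to a tail, then they are equal. -/
def PrefixFree (a b : List ℕ) : Prop :=
  ∀ r s, IsTail r → IsTail s → a ++ r = b ++ s → a = b ∧ r = s

/-- What follows the first string is a tail again, so the strings can be split off one by one; equal
lengths make both lists end together. -/
theorem flatten_append_inj {r s : List ℕ} (hr : IsTail r) (hs : IsTail s) :
    ∀ {L M : List (List ℕ)}, L.length = M.length → (∀ a ∈ L, ∃ t, a = 1 :: t) →
      (∀ a ∈ M, ∃ t, a = 1 :: t) → (∀ a ∈ L, ∀ b ∈ M, PrefixFree a b) →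
      L.flatten ++ r = M.flatten ++ s → L = M ∧ r = s
  | [], [], _, _, _, _, h => ⟨rfl, h⟩
  | a :: L, b :: M, hl, h1, h2, hp, h => by
    rw [List.flatten_cons, List.flatten_cons, List.append_assoc, List.append_assoc] at h
    obtain ⟨rfl, h'⟩ := hp a (by simp) b (by simp) _ _
      (hr.flatten_append fun x hx => h1 x (by simp [hx]))
      (hs.flatten_append fun x hx => h2 x (by simp [hx])) h
    obtain ⟨rfl, rfl⟩ := flatten_append_inj hr hs (by simpa using hl)
      (fun x hx => h1 x (by simp [hx])) (fun x hx => h2 x (by simp [hx]))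
      (fun x hx y hy => hp x (by simp [hx]) y (by simp [hy])) h'
    exact ⟨rfl, rfl⟩

theorem exists_perm_of_perm_ofFn {p : ℕ} {a b : Fin p → List ℕ}
    (h : (List.ofFn a).Perm (List.ofFn b)) : ∃ τ : Equiv.Perm (Fin p), ∀ i, a i = b (τ i) := by
  have : a ∘ Tuple.sort a = b ∘ Tuple.sort b := List.ofFn_injective <|
    (((Tuple.sort a).ofFn_comp_perm a).trans
      (h.trans ((Tuple.sort b).ofFn_comp_perm b).symm)).eq_of_pairwise'
      (Tuple.monotone_sort a).sortedLE_ofFn.pairwise (Tuple.monotone_sort b).sortedLE_ofFn.pairwise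
  refine ⟨(Tuple.sort a).symm.trans (Tuple.sort b), fun i => ?_⟩
  have := congrFun this ((Tuple.sort a).symm i)
  simpa using this

/-- Parsing recovers the sorted list of the branch codes, that is, the branch codes up to a
permutation. -/
theorem lexConcat_append_inj {p : ℕ} {a b : Fin p → List ℕ} {r s : List ℕ} (hr : IsTail r)
    (hs : IsTail s) (ha : ∀ i, ∃ t, a i = 1 :: t) (hb : ∀ i, ∃ t, b i = 1 :: t)
    (hp : ∀ i j, PrefixFree (a i) (b j))
    (h : lexConcat (List.ofFn a) ++ r = lexConcat (List.ofFn b) ++ s) :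
    (∃ τ : Equiv.Perm (Fin p), ∀ i, a i = b (τ i)) ∧ r = s := by
  have hm : ∀ c : Fin p → List ℕ, ∀ x, x ∈ (List.ofFn c).insertionSort (· ≤ ·) → ∃ i, c i = x := by
    intro c x hx
    rw [List.mem_insertionSort, List.mem_ofFn] at hx
    exact hx
  obtain ⟨he, rfl⟩ := flatten_append_inj hr hs (by simp)
    (fun x hx => by obtain ⟨i, rfl⟩ := hm a x hx; exact ha i)
    (fun x hx => by obtain ⟨i, rfl⟩ := hm b x hx; exact hb i)
    (fun x hx y hy => by
      obtain ⟨i, rfl⟩ := hm a x hx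
      obtain ⟨j, rfl⟩ := hm b y hy
      exact hp i j) h
  refine ⟨exists_perm_of_perm_ofFn ?_, rfl⟩
  have h1 := List.perm_insertionSort (· ≤ ·) (List.ofFn b)
  rw [← he] at h1
  exact (List.perm_insertionSort _ _).symm.trans h1

namespace StatementKind

/-- An automorphism of a statement graph. -/
structure IsAut (k : StatementKind) (σ : Fin k.order → Fin k.order) : Prop where
  bijective : σ.Bijective
  src : σ k.src = k.src
  snk : σ k.snk = k.snk
  edge : ∀ i j : Fin k.order, k.Edge i j ↔ k.Edge (σ i) (σ j)

theorem isAut_id (k : StatementKind) : k.IsAut id :=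
  ⟨Function.bijective_id, rfl, rfl, fun _ _ => Iff.rfl⟩

/-- A permutation of the branches of a case statement induces an automorphism. -/
theorem exists_isAut (k : StatementKind) {p : ℕ} (hk : k.order = p + 2)
    (hE : ∀ i j, k.Edge i j ↔ (i = 0 ∧ 1 ≤ j ∧ j ≤ p) ∨ (1 ≤ i ∧ i ≤ p ∧ j = p + 1))
    (τ : Equiv.Perm (Fin p)) : ∃ σ, k.IsAut σ ∧ ∀ (i : ℕ) (hi : i < p),
      σ ⟨i + 1, by omega⟩ = ⟨(τ ⟨i, hi⟩).1 + 1, by omega⟩ := by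
  let σ : Fin k.order → Fin k.order := fun i =>
    if h : 1 ≤ i.1 ∧ i.1 ≤ p then ⟨(τ ⟨i.1 - 1, by omega⟩).1 + 1, by omega⟩ else i
  have h1 : ∀ i : Fin k.order, ∀ h : 1 ≤ i.1 ∧ i.1 ≤ p,
      (σ i).1 = (τ ⟨i.1 - 1, by omega⟩).1 + 1 := fun i h => by simp only [σ, dif_pos h]
  have h2 : ∀ i : Fin k.order, ¬ (1 ≤ i.1 ∧ i.1 ≤ p) → σ i = i := fun i h => by
    simp only [σ, dif_neg h]
  have hb : ∀ i : Fin k.order, (1 ≤ i.1 ∧ i.1 ≤ p) → 1 ≤ (σ i).1 ∧ (σ i).1 ≤ p := fun i h => by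
    have := (τ ⟨i.1 - 1, by omega⟩).2
    rw [h1 i h]
    omega
  have hinj : σ.Injective := by
    intro i j hij
    by_cases hi : 1 ≤ i.1 ∧ i.1 ≤ p <;> by_cases hj : 1 ≤ j.1 ∧ j.1 ≤ p
    · have := congrArg Fin.val hij
      rw [h1 i hi, h1 j hj, Nat.add_right_cancel_iff, ← Fin.ext_iff, τ.injective.eq_iff,
        Fin.mk.injEq] at this
      exact Fin.ext (by omega)
    · exact (hj (by rw [← h2 j hj, ← hij]; exact hb i hi)).elim
    · exact (hi (by rw [← h2 i hi, hij]; exact hb j hj)).elim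
    · rw [← h2 i hi, hij, h2 j hj]
  refine ⟨σ, ⟨Finite.injective_iff_bijective.1 hinj, h2 _ (by simp [StatementKind.src]),
    h2 _ (by simp only [StatementKind.snk]; omega), fun i j => ?_⟩, fun i hi => Fin.ext ?_⟩
  · rw [hE, hE]
    have hi := h2 i
    have hi' := hb i
    have hj := h2 j
    have hj' := hb j
    rw [Fin.ext_iff] at hi hj
    omega
  · rw [h1 _ (by simp only; omega)]
    simp

theorem type_injective : Function.Injective type := by
  intro k k' h
  cases k <;> cases k' <;> simp [type] at * <;> omega

theorem two_le_type (k : StatementKind) : 2 ≤ k.type := by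
  cases k <;> simp [type]

theorem code_eq_cons (k : StatementKind) (c : Fin k.order → List ℕ) :
    ∃ t, k.code c = k.type :: t := by
  cases k <;> exact ⟨_, rfl⟩

/-- The codes of the vertices are determined by the code of a statement graph, up to an
automorphism. -/
theorem code_append_inj (k : StatementKind) {c c' : Fin k.order → List ℕ} {r s : List ℕ}
    (hr : IsTail r) (hs : IsTail s) (hc : ∀ i, ∃ t, c i = 1 :: t) (hc' : ∀ i, ∃ t, c' i = 1 :: t)
    (hp : ∀ i j, PrefixFree (c i) (c' j)) (h : k.code c ++ r = k.code c' ++ s) :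
    r = s ∧ ∃ σ, k.IsAut σ ∧ ∀ i, i ≠ k.src → c i = c' (σ i) := by
  cases k with
  | sequence =>
    simp only [code, List.cons_append, List.cons.injEq, true_and] at h
    obtain ⟨h1, rfl⟩ := hp _ _ _ _ hr hs h
    refine ⟨rfl, id, isAut_id _, ?_⟩
    rintro ⟨i, hi⟩ hne
    have hi0 : i ≠ 0 := fun h => hne (Fin.ext h)
    simp only [order] at hi
    obtain rfl : i = 1 := by omega
    exact h1
  | ifThenElse =>
    simp only [code, List.cons_append, List.cons.injEq, true_and, List.append_assoc] at h
    obtain ⟨⟨τ, hτ⟩, h'⟩ := lexConcat_append_inj (p := 2)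
      (a := fun i : Fin 2 => c ⟨i.1 + 1, by simp only [order]; omega⟩)
      (b := fun i : Fin 2 => c' ⟨i.1 + 1, by simp only [order]; omega⟩)
      (.append (hc _)) (.append (hc' _)) (fun _ => hc _) (fun _ => hc' _) (fun _ _ => hp _ _) h
    obtain ⟨h3, rfl⟩ := hp _ _ _ _ hr hs h'
    obtain ⟨σ, hσ, hστ⟩ := exists_isAut ifThenElse (p := 2) rfl
      (fun i j => by simp only [Edge]; omega) τ
    refine ⟨rfl, σ, hσ, ?_⟩
    rintro ⟨i, hi⟩ hne
    have hi0 : i ≠ 0 := fun h => hne (Fin.ext h)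
    simp only [order] at hi
    by_cases hi3 : i = 3
    · subst hi3
      exact h3.trans (congrArg c' hσ.snk.symm)
    · obtain ⟨j, rfl⟩ : ∃ j, i = j + 1 := ⟨i - 1, by omega⟩
      rw [hστ j (by omega)]
      exact hτ ⟨j, by omega⟩
  | pCase p hp3 =>
    simp only [code, List.cons_append, List.cons.injEq, true_and, List.append_assoc] at h
    obtain ⟨⟨τ, hτ⟩, h'⟩ := lexConcat_append_inj
      (.append (hc _)) (.append (hc' _)) (fun _ => hc _) (fun _ => hc' _) (fun _ _ => hp _ _) h
    obtain ⟨h3, rfl⟩ := hp _ _ _ _ hr hs h'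
    obtain ⟨σ, hσ, hστ⟩ := exists_isAut (pCase p hp3) (p := p) rfl
      (fun i j => Iff.rfl) τ
    refine ⟨rfl, σ, hσ, ?_⟩
    rintro ⟨i, hi⟩ hne
    have hi0 : i ≠ 0 := fun h => hne (Fin.ext h)
    simp only [order] at hi
    by_cases hi3 : i = p + 1
    · subst hi3
      exact h3.trans (congrArg c' hσ.snk.symm)
    · obtain ⟨j, rfl⟩ : ∃ j, i = j + 1 := ⟨i - 1, by omega⟩
      rw [hστ j (by omega)]
      exact hτ ⟨j, by omega⟩
  | _ =>
    simp only [code, List.cons_append, List.cons.injEq, true_and, List.append_assoc] at h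
    obtain ⟨h1, h'⟩ := hp _ _ _ _ (.append (hc _)) (.append (hc' _)) h
    obtain ⟨h2, rfl⟩ := hp _ _ _ _ hr hs h'
    refine ⟨rfl, id, isAut_id _, ?_⟩
    rintro ⟨i, hi⟩ hne
    have hi0 : i ≠ 0 := fun h => hne (Fin.ext h)
    simp only [order] at hi
    obtain rfl | rfl : i = 1 ∨ i = 2 := by omega
    · exact h1
    · exact h2

end StatementKind

/-! ### Programs with equal codes -/

namespace Program

/-- All vertices carry the initial code. -/
def AllOne (T : Program) : Prop := ∀ p, T.Pos p → T.label p = [1]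

theorem AllOne.child {k : StatementKind} {f : ℕ → Program} (h : (node k f).AllOne) {i : ℕ}
    (hi : i < k.order) : (f i).AllOne := fun p hp => h (i :: p) ⟨hi, hp⟩

theorem AllOne.code_eq_cons {T : Program} (h : T.AllOne) : ∃ t, T.code = 1 :: t := by
  cases T with
  | leaf c => exact ⟨[], h [] rfl⟩
  | node k f => exact ⟨_, rfl⟩

theorem prefixFree_code {T : Program} : ∀ {T' : Program}, T.AllOne → T'.AllOne →
    PrefixFree T.code T'.code := by
  -- A tail is empty or starts with 1, whereas the code of a statement graph starts with a type,
  -- which is at least 2. So a leaf is never confused with a node.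
  have aux : ∀ (k : StatementKind) (c : Fin k.order → List ℕ) (r s : List ℕ), IsTail r →
      r ≠ k.code c ++ s := by
    rintro k c r s hr rfl
    obtain ⟨t, ht⟩ := k.code_eq_cons c
    rw [ht] at hr
    rcases hr with hr | ⟨t', hr⟩
    · cases hr
    · have := (List.cons.inj hr).1
      have := k.two_le_type
      omega
  induction T with
  | leaf c =>
    intro T' h h' r s hr hs he
    obtain rfl : c = [1] := h [] rfl
    cases T' with
    | leaf c' =>
      obtain rfl : c' = [1] := h' [] rfl
      exact ⟨rfl, by simpa using he⟩
    | node k f => exact (aux k _ r s hr (List.cons.inj he).2).elim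
  | node k f ih =>
    intro T' h h' r s hr hs he
    cases T' with
    | leaf c' =>
      obtain rfl : c' = [1] := h' [] rfl
      exact (aux k _ s r hs (List.cons.inj he).2.symm).elim
    | node k' f' =>
      have he := (List.cons.inj he).2
      obtain rfl : k = k' := by
        obtain ⟨t, ht⟩ := k.code_eq_cons fun i => (f i).code
        obtain ⟨t', ht'⟩ := k'.code_eq_cons fun i => (f' i).code
        rw [ht, ht'] at he
        exact StatementKind.type_injective (List.cons.inj he).1
      obtain ⟨rfl, -⟩ := k.code_append_inj hr hs (fun i => (h.child i.2).code_eq_cons)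
        (fun i => (h'.child i.2).code_eq_cons)
        (fun i j => ih i (h.child i.2) (h'.child j.2)) he
      exact ⟨congrArg (List.cons 1) (List.append_cancel_right he), rfl⟩

/-- A bijection between the vertices of the flow graphs of two programs that preserves the source,
the sink, and the edges. -/
structure IsIso (T T' : Program) (φ : List ℕ → List ℕ) : Prop where
  bijOn : Set.BijOn φ {p | T.Pos p} {p | T'.Pos p}
  root : φ T.root = T'.root
  sink : φ T.sink = T'.sink
  edge : ∀ p q, T.Pos p → T.Pos q → (T.Edge p q ↔ T'.Edge (φ p) (φ q))

/-- The isomorphisms of the children are glued along an automorphism of the statement graph. Edges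
between children run from sinks to roots, which is why the induction has to preserve sinks as well.
-/
theorem exists_isIso_of_code_eq {T : Program} : ∀ {T' : Program}, T.WF → T'.WF → T.AllOne →
    T'.AllOne → T.code = T'.code → ∃ φ, T.IsIso T' φ := by
  induction T with
  | leaf c =>
    intro T' _ _ h h' he
    obtain rfl : c = [1] := h [] rfl
    cases T' with
    | leaf c' => exact ⟨id, Set.bijOn_id _, rfl, rfl, fun _ _ _ _ => Iff.rfl⟩
    | node k f =>
      obtain ⟨t, ht⟩ := k.code_eq_cons fun i => (f i).code
      rw [code, code, ht] at he
      cases he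
  | node k f ih =>
    intro T' hwf hwf' h h' he
    cases T' with
    | leaf c' =>
      obtain rfl : c' = [1] := h' [] rfl
      obtain ⟨t, ht⟩ := k.code_eq_cons fun i => (f i).code
      rw [code, code, ht] at he
      cases he
    | node k' f' =>
      have he := (List.cons.inj he).2
      obtain rfl : k = k' := by
        obtain ⟨t, ht⟩ := k.code_eq_cons fun i => (f i).code
        obtain ⟨t', ht'⟩ := k'.code_eq_cons fun i => (f' i).code
        rw [ht, ht'] at he
        exact StatementKind.type_injective (List.cons.inj he).1
      obtain ⟨-, σ, hσ, hc⟩ := k.code_append_inj (r := []) (s := []) (Or.inl rfl) (Or.inl rfl)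
        (fun i => (h.child i.2).code_eq_cons) (fun i => (h'.child i.2).code_eq_cons)
        (fun i j => prefixFree_code (h.child i.2) (h'.child j.2)) (congrArg (· ++ []) he)
      -- The code of a statement graph omits its source, about which parsing says nothing; there
      -- well-formedness provides the leaf `[1]` on both sides.
      have hc' : ∀ i : Fin k.order, (f i).code = (f' (σ i)).code := by
        intro i
        by_cases hi : i = k.src
        · rw [hi, hσ.src]
          change (f 0).code = (f' 0).code
          rw [hwf.1 0 (Or.inl rfl), hwf'.1 0 (Or.inl rfl)]
        · exact hc i hi
      have hφ := fun i : Fin k.order => ih i (hwf.2 i) (hwf'.2 (σ i)) (h.child i.2)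
        (h'.child (σ i).2) (hc' i)
      choose φ hφ using hφ
      -- The automorphism acts on the first index, the isomorphism of the child on the rest; the
      -- default `[]` occurs only off the positions.
      let Φ : List ℕ → List ℕ
        | [] => []
        | i :: p => if hi : i < k.order then (σ ⟨i, hi⟩).1 :: φ ⟨i, hi⟩ p else []
      have hΦ : ∀ (i : Fin k.order) p, Φ (i.1 :: p) = (σ i).1 :: φ i p := fun i p => by
        simp only [Φ, dif_pos i.2]
      refine ⟨Φ, ⟨?_, ?_, ?_⟩, ?_, ?_, ?_⟩
      · rintro (_ | ⟨i, p⟩) hp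
        · exact hp.elim
        · rw [hΦ ⟨i, hp.1⟩]
          exact ⟨(σ _).2, (hφ ⟨i, hp.1⟩).bijOn.mapsTo hp.2⟩
      · rintro (_ | ⟨i, p⟩) hp (_ | ⟨j, q⟩) hq hpq
        · exact hp.elim
        · exact hp.elim
        · exact hq.elim
        · rw [hΦ ⟨i, hp.1⟩, hΦ ⟨j, hq.1⟩] at hpq
          obtain ⟨h1, h2⟩ := List.cons.inj hpq
          obtain rfl : i = j := congrArg Fin.val (hσ.bijective.1 (Fin.ext h1))
          rw [(hφ ⟨i, hp.1⟩).bijOn.injOn hp.2 hq.2 h2]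
      · rintro (_ | ⟨j, q⟩) hq
        · exact hq.elim
        · obtain ⟨i, hi⟩ := hσ.bijective.2 ⟨j, hq.1⟩
          have hi' : (σ i).1 = j := congrArg Fin.val hi
          obtain ⟨p, hp, hpq⟩ := (hφ i).bijOn.surjOn (show (f' (σ i)).Pos q from hi' ▸ hq.2)
          exact ⟨i.1 :: p, ⟨i.2, hp⟩, by rw [hΦ, hi', hpq]⟩
      · change Φ (k.src.1 :: (f k.src).root) = k.src.1 :: (f' k.src).root
        rw [hΦ, (hφ _).root, hσ.src]
      · change Φ (k.snk.1 :: (f k.snk).sink) = k.snk.1 :: (f' k.snk).sink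
        rw [hΦ, (hφ _).sink, hσ.snk]
      · rintro (_ | ⟨i, p⟩) (_ | ⟨j, q⟩) hp hq
        · exact hp.elim
        · exact hp.elim
        · exact hq.elim
        · have hsink := (hφ ⟨i, hp.1⟩).bijOn.injOn.eq_iff hp.2 (pos_sink _)
          have hroot := (hφ ⟨j, hq.1⟩).bijOn.injOn.eq_iff hq.2 (pos_root _)
          rw [(hφ ⟨i, hp.1⟩).sink] at hsink
          rw [(hφ ⟨j, hq.1⟩).root] at hroot
          rw [hΦ ⟨i, hp.1⟩, hΦ ⟨j, hq.1⟩]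
          refine or_congr ?_ (and_congr (hσ.edge ⟨i, hp.1⟩ ⟨j, hq.1⟩)
            (and_congr hsink.symm hroot.symm))
          constructor
          · rintro ⟨rfl, hi, hE⟩
            exact ⟨rfl, (σ _).2, ((hφ ⟨i, hp.1⟩).edge p q hp.2 hq.2).1 hE⟩
          · rintro ⟨h1, -, hE⟩
            obtain rfl : i = j := congrArg Fin.val (hσ.bijective.1 (Fin.ext h1))
            exact ⟨rfl, hp.1, ((hφ ⟨i, hp.1⟩).edge p q hp.2 hq.2).2 hE⟩

theorem IsIso.isomorphic {T T' : Program} {φ : List ℕ → List ℕ} (h : T.IsIso T' φ) :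
    T.toGraph.Isomorphic T'.toGraph :=
  ⟨⟨h.bijOn.equiv φ, fun a b => h.edge a.1 b.1 a.2 b.2, Subtype.ext h.root⟩⟩

end Program

/-! ### Dijkstra graphs as flow graphs of programs -/

namespace RootedDigraph

/-- The labels have to be carried along: well-formedness survives an expansion only at an expansible
position. -/
theorem IsLabeledDijkstra.exists_program {G : RootedDigraph.{u}} {X : Set G.V}
    (h : G.IsLabeledDijkstra X) : ∃ T : Program, T.WF ∧ T.AllOne ∧
      ∃ e : G.Iso T.toGraph, ∀ x, x ∈ X ↔ T.IsX (e.toEquiv x).1 := by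
  induction h with
  | trivial G hV hE =>
    refine ⟨.leaf [1], True.intro, fun _ _ => rfl, ⟨⟨fun _ => ⟨[], rfl⟩, fun _ => G.source,
      fun a => (hV a).symm, fun a => Subtype.ext a.2.symm⟩, fun a b => ?_, rfl⟩, fun x => ?_⟩
    · exact iff_of_false (hE a b) id
    · exact iff_of_true True.intro True.intro
  | expand G X v k hG hv ih =>
    obtain ⟨T, hwf, hT, e, hX⟩ := ih
    have hπ : T.Pos (e.toEquiv v).1 := (e.toEquiv v).2
    obtain ⟨f, hf1, hf2⟩ := T.exists_iso_expand k (fun _ => [1]) hπ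
    refine ⟨_, Program.wf_expandAt (fun _ _ => rfl) hπ ((hX v).1 hv) hwf, ?_,
      (e.expand v k).trans f, ?_⟩
    · intro p hp
      rcases (Program.pos_expandAt hπ).1 hp with ⟨h, hne⟩ | ⟨i, hi, rfl⟩
      · rw [Program.label_expandAt hπ h hne, hT p h]
      · exact Program.label_expandAt_append hπ
    · rintro (w | i)
      · have h1 := hf1 ⟨e.toEquiv w.1, e.toEquiv.injective.ne w.2⟩
        change w.1 ∈ X ↔ Program.IsX _ (f.toEquiv (Sum.inl _)).1
        rw [hX]
        erw [h1]
        exact (Program.isX_expandAt hπ (e.toEquiv w.1).2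
          fun h => w.2 (e.toEquiv.injective (Subtype.ext h))).symm
      · change i ≠ k.src ↔ Program.IsX _ (f.toEquiv (Sum.inr i)).1
        rw [hf2 i, Program.isX_expandAt_append hπ ((hX v).1 hv), ne_eq, Fin.ext_iff]
        rfl
  | iso G G' X e hG ih =>
    obtain ⟨T, hwf, hT, f, hX⟩ := ih
    refine ⟨T, hwf, hT, e.symm.trans f, fun x => ?_⟩
    obtain ⟨y, rfl⟩ := e.toEquiv.surjective x
    rw [e.toEquiv.injective.mem_set_image, hX]
    change _ ↔ T.IsX (f.toEquiv (e.toEquiv.symm (e.toEquiv y))).1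
    rw [Equiv.symm_apply_apply]

/-- A Dijkstra graph is the flow graph of a program, the code of which is its only code. -/
theorem IsDijkstra.exists_program {G : RootedDigraph.{u}} (h : G.IsDijkstra) :
    ∃ T : Program, T.WF ∧ T.AllOne ∧ G.Isomorphic T.toGraph ∧ ∀ c, G.IsCode c ↔ c = T.code := by
  obtain ⟨X, h⟩ := h
  obtain ⟨T, hwf, hT, e, -⟩ := h.exists_program
  have hl : (fun p : T.toGraph.V => T.label p.1) = fun _ => [1] := funext fun p => hT _ p.2
  have hT' : ∀ c, T.toGraph.IsCode c ↔ c = T.code := fun c => by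
    have := Program.codeFrom_iff _ T rfl hwf c
    rw [hl] at this
    exact this
  exact ⟨T, hwf, hT, ⟨e⟩, fun c => ⟨fun h => (hT' c).1 (e.isCode h),
    fun h => e.symm.isCode ((hT' c).2 h)⟩⟩

end RootedDigraph

end StructuredProgram

theorem mainTheorem3
    (G : StructuredProgram.RootedDigraph.{u}) (G' : StructuredProgram.RootedDigraph.{v})
    (hG : G.IsDijkstra) (hG' : G'.IsDijkstra) :
    (∃! c : List ℕ, G.IsCode c) ∧ (∃! c' : List ℕ, G'.IsCode c') ∧
      ∀ c c' : List ℕ, G.IsCode c → G'.IsCode c' → (G.Isomorphic G' ↔ c = c') := by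
  obtain ⟨T, hwf, hT, ⟨e⟩, hc⟩ := hG.exists_program
  obtain ⟨T', hwf', hT', ⟨e'⟩, hc'⟩ := hG'.exists_program
  refine ⟨⟨T.code, (hc _).2 rfl, fun c h => (hc c).1 h⟩,
    ⟨T'.code, (hc' _).2 rfl, fun c h => (hc' c).1 h⟩, fun c c' h h' => ⟨?_, ?_⟩⟩
  · rintro ⟨f⟩
    exact ((hc' c).1 (f.isCode h)).trans ((hc' c').1 h').symm
  · intro he
    have hcode : T.code = T'.code := by rw [← (hc c).1 h, he, (hc' c').1 h']
    obtain ⟨φ, hφ⟩ := StructuredProgram.Program.exists_isIso_of_code_eq hwf hwf' hT hT' hcode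
    obtain ⟨g⟩ := hφ.isomorphic
    exact ⟨(e.trans g).trans e'.symm⟩
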